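/- Theorem. Let $p$ be a prime, let $q$ be a power of $p$, let $E$ be a complete discretely valued field with residue field $\mathbb{F}_q$ (of characteristic $0$ or $p$), with valuation ring $\mathfrak{o}_E$, and let $\varpi$ be a uniformizer of $E$. Let $L$ be a perfect field containing $\mathbb{F}_q$ which is complete with respect to a nontrivial multiplicative nonarchimedean norm $|\cdot|$, with valuation ring $\mathfrak{o}_L$. For a perfect $\mathbb{F}_q$-algebra $R$ put $W(R)_E = W(R) \otimes_{W(\mathbb{F}_q)} \mathfrak{o}_E$, where $W$ denotes $p$-typical Witt vectors, and write $[\overline{x}] \in W(R)_E$ for the Teichmüller lift of $\overline{x} \in R$. Let $A_{L,E} = W(\mathfrak{o}_L)_E[[\overline{x}] : \overline{x} \in L]$ be the subring of $W(L)_E$ generated by (the image of) $W(\mathfrak{o}_L)_E$ and the elements $[\overline{x}]$, $\overline{x}\in L$. Each element of $A_{L,E}$ can be written uniquely as a $\varpi$-adically convergent sum $\sum_{n \geq 0} \varpi^n [\overline{x}_n]$ with $\overline{x}_n \in L$, and the sequence $(\overline{x}_n)$ is bounded. Fix $r > 0$, put \[ \lambda_r\Big( \sum_{n \geq 0} \varpi^n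 [\overline{x}_n] \Big) = \max_n \{ p^{-n} |\overline{x}_n|^r \}, \] which is a norm on $A_{L,E}$, and let $A^r_{L,E}$ be the completion of $A_{L,E}$ with respect to $\lambda_r$. Then for every integer $n \geq 0$ and all real $\rho_1, \dots, \rho_n > 0$, the weighted Tate algebra $A^r_{L,E}\{T_1/\rho_1,\dots,T_n/\rho_n\}$, that is, the ring of those power series $\sum_I c_I T^I \in A^r_{L,E}[[T_1,\dots,T_n]]$ for which $\lambda_r(c_I)\, \rho_1^{i_1} \cdots \rho_n^{i_n} \to 0$ as $i_1 + \cdots + i_n \to \infty$, is noetherian. -/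

import Mathlib

namespace Robba

open IsLocalRing

set_option linter.unusedSectionVars false

section WittLift
variable (p : ℕ) [Fact p.Prime]

theorem ghost_mem {O : Type*} [CommRing O] (I : Ideal O) (hp : (p : O) ∈ I) (n : ℕ)
    (x : WittVector p O) (hx : ∀ i, x.coeff i ∈ I) :
    WittVector.ghostComponent n x ∈ I ^ (n + 1) := by
  rw [WittVector.ghostComponent_apply, wittPolynomial, map_sum]
  refine Ideal.sum_mem _ fun i hi => ?_
  have hi' : i ≤ n := by simpa [Nat.lt_succ_iff] using hi
  rw [MvPolynomial.aeval_monomial]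
  simp only [Finsupp.prod_single_index, pow_zero, map_pow, map_natCast]
  have h1 : n - i + 1 ≤ p ^ (n - i) :=
    Nat.succ_le_of_lt (Nat.lt_pow_self (Fact.out : p.Prime).one_lt)
  have h2 : x.coeff i ^ p ^ (n - i) ∈ I ^ (n - i + 1) :=
    Ideal.pow_le_pow_right h1 (Ideal.pow_mem_pow (hx i) _)
  have h3 := Ideal.mul_mem_mul (Ideal.pow_mem_pow hp i) h2
  rw [← pow_add, show i + (n - i + 1) = n + 1 by omega] at h3
  exact h3

variable (O : Type*) [CommRing O] [IsLocalRing O] [CharP (ResidueField O) p]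

theorem natCast_mem : (p : O) ∈ maximalIdeal O := by
  rw [← residue_eq_zero_iff, map_natCast, CharP.cast_eq_zero]

/-- The map induced by the `n`-th ghost component, from Witt vectors of the residue field to the
quotient by the `(n + 1)`-st power of the maximal ideal. -/
noncomputable def ghostMod (n : ℕ) :
    WittVector p (ResidueField O) →+* O ⧸ maximalIdeal O ^ (n + 1) :=
  RingHom.liftOfSurjective (WittVector.map (residue O))
    (WittVector.map_surjective _ residue_surjective)
    ⟨(Ideal.Quotient.mk _).comp (WittVector.ghostComponent n), by
      intro x hx
      rw [RingHom.mem_ker, WittVector.map_eq_zero_iff] at hx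
      rw [RingHom.mem_ker, RingHom.comp_apply, Ideal.Quotient.eq_zero_iff_mem]
      exact ghost_mem p _ (natCast_mem p O) n x fun i => (residue_eq_zero_iff _).1 (hx i)⟩

theorem ghostMod_map (n : ℕ) (x : WittVector p O) :
    ghostMod p O n (WittVector.map (residue O) x) =
      Ideal.Quotient.mk _ (WittVector.ghostComponent n x) :=
  RingHom.liftOfSurjective_comp_apply ..

variable [PerfectRing (ResidueField O) p]

/-- `ghostMod` precomposed with the inverse of the `n`-th power of Frobenius. -/
noncomputable def wittLiftMod (n : ℕ) :
    WittVector p (ResidueField O) →+* O ⧸ maximalIdeal O ^ (n + 1) :=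
  (ghostMod p O n).comp
    (WittVector.map ((frobeniusEquiv (ResidueField O) p).symm ^ n :
      ResidueField O →+* ResidueField O))

theorem wittLiftMod_compat (n : ℕ) :
    (Ideal.Quotient.factorPow (maximalIdeal O) (Nat.le_succ (n + 1))).comp
      (wittLiftMod p O (n + 1)) = wittLiftMod p O n := by
  apply WittVector.eq_of_apply_teichmuller_eq
  · refine ⟨n + 1, ?_⟩
    rw [← map_natCast (Ideal.Quotient.mk (maximalIdeal O ^ (n + 1))), ← map_pow,
      Ideal.Quotient.eq_zero_iff_mem]
    exact Ideal.pow_mem_pow (natCast_mem p O) _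
  intro x
  have key : ∀ (m : ℕ) (a : O), ghostMod p O m (WittVector.teichmuller p (residue O a)) =
      Ideal.Quotient.mk _ (a ^ p ^ m) := by
    intro m a
    rw [← WittVector.map_teichmuller, ghostMod_map, WittVector.ghostComponent_teichmuller]
  obtain ⟨a, ha⟩ := residue_surjective (R := O)
    (((frobeniusEquiv (ResidueField O) p).symm ^ (n + 1) :
      ResidueField O →+* ResidueField O) x)
  have ha' : residue O (a ^ p) = ((frobeniusEquiv (ResidueField O) p).symm ^ n :
      ResidueField O →+* ResidueField O) x := by
    rw [map_pow, ha, pow_succ']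
    simp
  simp only [wittLiftMod, RingHom.comp_apply, WittVector.map_teichmuller]
  rw [← ha, ← ha', key, key, ← pow_mul, ← pow_succ']
  rfl

variable [IsAdicComplete (maximalIdeal O) O]

/-- For a complete local ring `O` with perfect residue field of characteristic `p`, the canonical
(in fact unique) ring homomorphism from the Witt vectors of the residue field to `O` lifting the
identity of the residue field. -/
noncomputable def wittLift : WittVector p (ResidueField O) →+* O :=
  IsAdicComplete.StrictMono.liftRingHom (maximalIdeal O) Order.succ_strictMono _ (wittLiftMod_compat p O _)

theorem residue_wittLift (x : WittVector p (ResidueField O)) :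
    residue O (wittLift p O x) = x.coeff 0 := by
  obtain ⟨y, rfl⟩ := WittVector.map_surjective (p := p) (residue O) residue_surjective x
  have h := IsAdicComplete.StrictMono.mk_liftRingHom (maximalIdeal O) Order.succ_strictMono _
    (wittLiftMod_compat p O _) (n := 0) (WittVector.map (residue O) y)
  have h2 : wittLiftMod p O 0 (WittVector.map (residue O) y) =
      Ideal.Quotient.mk _ (WittVector.ghostComponent 0 y) := by
    rw [← ghostMod_map, wittLiftMod, RingHom.comp_apply]
    congr 1
  have h4 : Ideal.Quotient.mk (maximalIdeal O ^ (0 + 1))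
      (wittLift p O (WittVector.map (residue O) y)) =
      Ideal.Quotient.mk _ (WittVector.ghostComponent 0 y) := h.trans h2
  rw [Ideal.Quotient.eq] at h4
  have h3 : wittLift p O (WittVector.map (residue O) y) - WittVector.ghostComponent 0 y ∈
      maximalIdeal O := by simpa using h4
  rw [← residue_eq_zero_iff, map_sub, sub_eq_zero] at h3
  rw [h3, WittVector.ghostComponent_apply]
  simp

end WittLift

section Tensor
open scoped TensorProduct

variable (p : ℕ) [Fact p.Prime]

/-- `W(k)`-algebra structure on `W(R)` for a `k`-algebra `R`. -/
noncomputable instance (priority := 50) wittAlgebra (k R : Type*) [Field k] [CommRing R]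
    [Algebra k R] :
    Algebra (WittVector p k) (WittVector p R) :=
  (WittVector.map (algebraMap k R)).toAlgebra

variable (O : Type*) [CommRing O] [IsDomain O] [IsDiscreteValuationRing O]
  [IsAdicComplete (maximalIdeal O) O] [CharP (ResidueField O) p] [PerfectRing (ResidueField O) p]

/-- The structure of `W(𝔽_q)`-algebra on `𝔬_E`. -/
noncomputable instance (priority := 50) wittLiftAlgebra :
    Algebra (WittVector p (ResidueField O)) O :=
  (wittLift p O).toAlgebra

/-- The ring `W(R)_E = W(R) ⊗_{W(𝔽_q)} 𝔬_E`, where `O = 𝔬_E` is a complete discrete valuation ring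
with residue field `𝔽_q`, and `R` is an `𝔽_q`-algebra. -/
abbrev RamWitt (R : Type*) [CommRing R] [Algebra (ResidueField O) R] : Type _ :=
  WittVector p R ⊗[WittVector p (ResidueField O)] O

variable {O} {R : Type*} [CommRing R] [Algebra (ResidueField O) R]

/-- The Teichmüller lift `[a]` in `W(R)_E`. -/
noncomputable def teich (a : R) : RamWitt p O R :=
  WittVector.teichmuller p a ⊗ₜ[WittVector p (ResidueField O)] (1 : O)

/-- The image of `c ∈ O` in `W(R)_E`. -/
noncomputable def scal (R : Type*) [CommRing R] [Algebra (ResidueField O) R] :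
    O →+* RamWitt p O R :=
  (Algebra.TensorProduct.includeRight : O →ₐ[WittVector p (ResidueField O)] _).toRingHom


variable {p}

theorem teich_zero : teich p (0 : R) = (0 : RamWitt p O R) := by
  rw [teich, WittVector.teichmuller_zero, TensorProduct.zero_tmul]

theorem teich_one : teich p (1 : R) = (1 : RamWitt p O R) := by
  rw [teich, map_one]; rfl

theorem teich_mul (a b : R) :
    teich p (a * b) = (teich p a * teich p b : RamWitt p O R) := by
  rw [teich, teich, teich, map_mul, Algebra.TensorProduct.tmul_mul_tmul, mul_one]

theorem scal_apply (c : O) :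
    scal p R c = (1 : WittVector p R) ⊗ₜ[WittVector p (ResidueField O)] c := rfl

variable (p O R) in
/-- The reduction map `W(R)_E → R`. -/
noncomputable def red : RamWitt p O R →+* R :=
  letI : Algebra (WittVector p (ResidueField O)) R :=
    ((algebraMap (ResidueField O) R).comp WittVector.constantCoeff).toAlgebra
  (Algebra.TensorProduct.lift
    (S := WittVector p (ResidueField O))
    ({ WittVector.constantCoeff with
        commutes' := fun w => WittVector.map_coeff _ w 0 } :
      WittVector p R →ₐ[WittVector p (ResidueField O)] R)
    ({ (algebraMap (ResidueField O) R).comp (residue O) with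
        commutes' := fun w => congrArg (algebraMap (ResidueField O) R) (residue_wittLift p O w) } :
      O →ₐ[WittVector p (ResidueField O)] R)
    (fun _ _ => Commute.all _ _)).toRingHom

theorem red_teich (a : R) : red p O R (teich p a) = a := by
  let : Algebra (WittVector p (ResidueField O)) R :=
    ((algebraMap (ResidueField O) R).comp WittVector.constantCoeff).toAlgebra
  refine (Algebra.TensorProduct.lift_tmul _ _ _ _ _).trans ?_
  rw [map_one, mul_one]
  exact WittVector.teichmuller_coeff_zero p a

theorem red_scal (c : O) : red p O R (scal p R c) = algebraMap _ R (residue O c) := by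
  let : Algebra (WittVector p (ResidueField O)) R :=
    ((algebraMap (ResidueField O) R).comp WittVector.constantCoeff).toAlgebra
  refine (Algebra.TensorProduct.lift_tmul _ _ _ _ _).trans ?_
  rw [map_one, one_mul]
  rfl

theorem exists_eq_teich_add_of_witt [CharP R p] [PerfectRing R p] {ϖ : O} (hϖ : Irreducible ϖ)
    (w : WittVector p R) :
    ∃ y : RamWitt p O R,
      w ⊗ₜ[WittVector p (ResidueField O)] (1 : O) = teich p (w.coeff 0) + scal p R ϖ * y := by
  have h0 : w - WittVector.teichmuller p (w.coeff 0) ∈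
      Ideal.span {(p : WittVector p R)} := by
    rw [← WittVector.ker_constantCoeff, RingHom.mem_ker, map_sub]
    simp
  obtain ⟨v, hv⟩ := Ideal.mem_span_singleton.1 h0
  have hp : (p : O) ∈ Ideal.span {ϖ} := by
    rw [← hϖ.maximalIdeal_eq]; exact natCast_mem p O
  obtain ⟨e, he⟩ := Ideal.mem_span_singleton.1 hp
  refine ⟨v ⊗ₜ e, ?_⟩
  rw [scal_apply, Algebra.TensorProduct.tmul_mul_tmul, one_mul, ← he, teich,
    ← sub_eq_iff_eq_add', ← TensorProduct.sub_tmul, hv]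
  rw [← nsmul_eq_mul, ← nsmul_one p, TensorProduct.tmul_smul, TensorProduct.smul_tmul']

theorem exists_eq_teich_add [CharP R p] [PerfectRing R p] {ϖ : O} (hϖ : Irreducible ϖ)
    (x : RamWitt p O R) :
    ∃ (a : R) (y : RamWitt p O R), x = teich p a + scal p R ϖ * y := by
  induction x using TensorProduct.induction_on with
  | zero => exact ⟨0, 0, by rw [teich_zero]; simp⟩
  | tmul w e =>
    set t : WittVector p (ResidueField O) := WittVector.teichmuller p (residue O e) with ht
    have h1 : e - wittLift p O t ∈ Ideal.span {ϖ} := by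
      rw [← hϖ.maximalIdeal_eq, ← residue_eq_zero_iff, map_sub, residue_wittLift]
      simp [ht]
    obtain ⟨e', he'⟩ := Ideal.mem_span_singleton.1 h1
    have h2 : e = t • (1 : O) + ϖ * e' := by
      rw [← he', Algebra.smul_def, mul_one]
      exact (add_sub_cancel (wittLift p O t) e).symm
    obtain ⟨y, hy⟩ := exists_eq_teich_add_of_witt hϖ (O := O) (t • w)
    refine ⟨(t • w).coeff 0, y + w ⊗ₜ e', ?_⟩
    rw [mul_add, ← add_assoc, ← hy, scal_apply, Algebra.TensorProduct.tmul_mul_tmul, one_mul]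
    conv_lhs => rw [h2, TensorProduct.tmul_add, TensorProduct.tmul_smul, TensorProduct.smul_tmul']
  | add x y hx hy =>
    obtain ⟨a, u, rfl⟩ := hx
    obtain ⟨b, v, rfl⟩ := hy
    obtain ⟨z, hz⟩ := exists_eq_teich_add_of_witt hϖ (O := O)
      (WittVector.teichmuller p a + WittVector.teichmuller p b)
    rw [TensorProduct.add_tmul] at hz
    refine ⟨(WittVector.teichmuller p a + WittVector.teichmuller p b).coeff 0, z + (u + v), ?_⟩
    have hz' : teich p a + teich p b = teich p
      ((WittVector.teichmuller p a + WittVector.teichmuller p b).coeff 0) + scal p R ϖ * z := hz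
    linear_combination hz'

theorem scal_mul_injective {L : Type*} [Field L] [CharP L p] [PerfectRing L p]
    [Algebra (ResidueField O) L] {ϖ : O} (hϖ : Irreducible ϖ) {x y : RamWitt p O L}
    (h : scal p L ϖ * x = scal p L ϖ * y) : x = y := by
  have hinj : Function.Injective
      (algebraMap (WittVector p (ResidueField O)) (WittVector p L)) :=
    WittVector.map_injective _ (algebraMap (ResidueField O) L).injective
  have : Module.IsTorsionFree (WittVector p (ResidueField O)) (WittVector p L) := by
    refine ⟨fun c hc a b hab => ?_⟩
    have hc' : algebraMap _ (WittVector p L) c ≠ 0 := by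
      rw [Ne, map_eq_zero_iff _ hinj]; exact hc.ne_zero
    simp only [Algebra.smul_def] at hab
    exact mul_left_cancel₀ hc' hab
  have : Module.Flat (WittVector p (ResidueField O)) (WittVector p L) := inferInstance
  have h1 : Function.Injective (LinearMap.mulLeft (WittVector p (ResidueField O)) ϖ) :=
    fun a b hab => mul_left_cancel₀ hϖ.ne_zero hab
  have h2 := Module.Flat.lTensor_preserves_injective_linearMap (M := WittVector p L) _ h1
  have h3 : ∀ z : RamWitt p O L, scal p L ϖ * z =
      LinearMap.lTensor (WittVector p L)
        (LinearMap.mulLeft (WittVector p (ResidueField O)) ϖ) z := by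
    intro z
    induction z using TensorProduct.induction_on with
    | zero => simp
    | tmul w e => rw [scal_apply, Algebra.TensorProduct.tmul_mul_tmul, one_mul]; rfl
    | add x y hx hy => rw [mul_add, hx, hy, map_add]
  exact h2 (by rw [← h3, ← h3, h])


/-- `x = ∑ ϖ ^ n [a n]`, the sum being `ϖ`-adically convergent. -/
def IsTeichExpansion (ϖ : O) (x : RamWitt p O R) (a : ℕ → R) : Prop :=
  ∀ N : ℕ, scal p R (ϖ ^ N) ∣ x - ∑ n ∈ Finset.range N, scal p R (ϖ ^ n) * teich p (a n)

theorem IsTeichExpansion.cons {ϖ : O} {x y : RamWitt p O R} {a : ℕ → R}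
    (h : x = teich p (a 0) + scal p R ϖ * y) (hy : IsTeichExpansion ϖ y fun n => a (n + 1)) :
    IsTeichExpansion ϖ x a := by
  intro N
  cases N with
  | zero => simp
  | succ N =>
    obtain ⟨z, hz⟩ := hy N
    refine ⟨z, ?_⟩
    rw [Finset.sum_range_succ', h, pow_succ', map_mul, mul_assoc, ← hz, mul_sub, Finset.mul_sum]
    simp only [pow_succ', map_mul, pow_zero, map_one, one_mul, mul_assoc]
    ring

theorem exists_isTeichExpansion [CharP R p] [PerfectRing R p] {ϖ : O} (hϖ : Irreducible ϖ)
    (x : RamWitt p O R) : ∃ a : ℕ → R, IsTeichExpansion ϖ x a := by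
  choose hd tl h using exists_eq_teich_add (p := p) (R := R) hϖ
  refine ⟨fun n => hd (tl^[n] x), fun N => ?_⟩
  suffices H : ∀ N x, scal p R (ϖ ^ N) ∣
      x - ∑ n ∈ Finset.range N, scal p R (ϖ ^ n) * teich p (hd (tl^[n] x)) from H N x
  intro N
  induction N with
  | zero => simp
  | succ N ih =>
    intro x
    obtain ⟨z, hz⟩ := ih (tl x)
    refine ⟨z, ?_⟩
    rw [Finset.sum_range_succ', pow_succ', map_mul, mul_assoc, ← hz, mul_sub, Finset.mul_sum]
    simp only [pow_succ', map_mul, pow_zero, map_one, one_mul, mul_assoc, Function.iterate_succ,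
      Function.comp_apply, Function.iterate_zero, id]
    nth_rewrite 1 [h x]
    ring

/-- The `n`-th coefficient in the Teichmüller expansion of `x`. When `R` is a field, the expansion is
unique (`IsTeichExpansion.unique`). -/
noncomputable def digit [CharP R p] [PerfectRing R p] {ϖ : O} (hϖ : Irreducible ϖ)
    (x : RamWitt p O R) : ℕ → R :=
  (exists_isTeichExpansion hϖ x).choose

theorem isTeichExpansion_digit [CharP R p] [PerfectRing R p] {ϖ : O} (hϖ : Irreducible ϖ)
    (x : RamWitt p O R) : IsTeichExpansion ϖ x (digit hϖ x) :=
  (exists_isTeichExpansion hϖ x).choose_spec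

section Field
variable {L : Type*} [Field L] [CharP L p] [PerfectRing L p]
    [Algebra (ResidueField O) L] {ϖ : O}

theorem red_uniformizer (hϖ : Irreducible ϖ) : red p O L (scal p L ϖ) = 0 := by
  have h0 : residue O ϖ = 0 := by
    rw [residue_eq_zero_iff, hϖ.maximalIdeal_eq]; exact Ideal.mem_span_singleton_self _
  rw [red_scal, h0, map_zero]

theorem IsTeichExpansion.head (hϖ : Irreducible ϖ) {x : RamWitt p O L} {a : ℕ → L}
    (h : IsTeichExpansion ϖ x a) : red p O L x = a 0 := by
  obtain ⟨z, hz⟩ := h 1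
  have h1 := congrArg (red p O L) hz
  simpa [red_teich, red_uniformizer hϖ, sub_eq_zero] using h1

theorem IsTeichExpansion.tail (hϖ : Irreducible ϖ) {x y : RamWitt p O L} {a : ℕ → L} {b : L}
    (hxy : x = teich p b + scal p L ϖ * y) (h : IsTeichExpansion ϖ x a) :
    a 0 = b ∧ IsTeichExpansion ϖ y fun n => a (n + 1) := by
  have h0 : a 0 = b := by
    rw [← h.head hϖ, hxy, map_add, map_mul, red_teich, red_uniformizer hϖ, zero_mul, add_zero]
  refine ⟨h0, fun N => ?_⟩
  obtain ⟨z, hz⟩ := h (N + 1)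
  refine ⟨z, scal_mul_injective hϖ ?_⟩
  rw [← mul_assoc, ← map_mul, ← pow_succ', ← hz, Finset.sum_range_succ', hxy, h0, mul_sub,
    Finset.mul_sum]
  simp only [pow_succ', map_mul, pow_zero, map_one, one_mul, mul_assoc]
  ring

theorem IsTeichExpansion.unique (hϖ : Irreducible ϖ) {x : RamWitt p O L} {a b : ℕ → L}
    (ha : IsTeichExpansion ϖ x a) (hb : IsTeichExpansion ϖ x b) : a = b := by
  funext n
  induction n generalizing x a b with
  | zero => rw [← ha.head hϖ, ← hb.head hϖ]
  | succ n ih =>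
    obtain ⟨c, y, hy⟩ := exists_eq_teich_add hϖ x
    exact ih (ha.tail hϖ hy).2 (hb.tail hϖ hy).2

variable (hϖ : Irreducible ϖ)

theorem digit_zero_of_eq {x y : RamWitt p O L} {b : L}
    (hxy : x = teich p b + scal p L ϖ * y) : digit hϖ x 0 = b :=
  ((isTeichExpansion_digit hϖ x).tail hϖ hxy).1

theorem digit_succ_of_eq {x y : RamWitt p O L} {b : L}
    (hxy : x = teich p b + scal p L ϖ * y) (n : ℕ) : digit hϖ x (n + 1) = digit hϖ y n :=
  congrFun (((isTeichExpansion_digit hϖ x).tail hϖ hxy).2.unique hϖ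
    (isTeichExpansion_digit hϖ y)) n

theorem exists_tail (x : RamWitt p O L) :
    ∃ y, x = teich p (digit hϖ x 0) + scal p L ϖ * y ∧
      ∀ n, digit hϖ x (n + 1) = digit hϖ y n := by
  obtain ⟨b, y, hy⟩ := exists_eq_teich_add hϖ x
  refine ⟨y, ?_, digit_succ_of_eq hϖ hy⟩
  rw [digit_zero_of_eq hϖ hy, ← hy]

theorem digit_teich_mul (b : L) (x : RamWitt p O L) (n : ℕ) :
    digit hϖ (teich p b * x) n = b * digit hϖ x n := by
  induction n generalizing x with
  | zero =>
    obtain ⟨y, hy, -⟩ := exists_tail hϖ x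
    refine digit_zero_of_eq hϖ (y := teich p b * y) ?_
    conv_lhs => rw [hy]
    rw [teich_mul]; ring
  | succ n ih =>
    obtain ⟨y, hy, hy'⟩ := exists_tail hϖ x
    rw [hy', ← ih]
    refine digit_succ_of_eq hϖ (b := b * digit hϖ x 0) ?_ n
    conv_lhs => rw [hy]
    rw [teich_mul]; ring

theorem digit_zero (n : ℕ) : digit hϖ (0 : RamWitt p O L) n = 0 := by
  have := digit_teich_mul hϖ (0 : L) 0 n
  rwa [mul_zero, zero_mul] at this

theorem digit_uniformizer_mul_zero (x : RamWitt p O L) : digit hϖ (scal p L ϖ * x) 0 = 0 :=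
  digit_zero_of_eq hϖ (y := x) (by rw [teich_zero, zero_add])

theorem digit_uniformizer_mul_succ (x : RamWitt p O L) (n : ℕ) :
    digit hϖ (scal p L ϖ * x) (n + 1) = digit hϖ x n :=
  digit_succ_of_eq hϖ (y := x) (by rw [teich_zero, zero_add]) n

end Field

end Tensor

section Gauss
open scoped TensorProduct NNReal

variable (p : ℕ) [Fact p.Prime] (O : Type*) [CommRing O] [IsDomain O] [IsDiscreteValuationRing O]
  [IsAdicComplete (maximalIdeal O) O] [CharP (ResidueField O) p] [Finite (ResidueField O)]
  (L : Type*) [NontriviallyNormedField L] [IsUltrametricDist L] [CharP L p] [PerfectRing L p]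
  [Algebra (ResidueField O) L]

/-- The valuation ring of a nonarchimedean normed field. -/
noncomputable abbrev integerRing (K : Type*) [NormedField K] [IsUltrametricDist K] : ValuationSubring K :=
  (NormedField.valuation (K := K)).valuationSubring

theorem mem_integerRing {K : Type*} [NormedField K] [IsUltrametricDist K] {x : K} :
    x ∈ integerRing K ↔ ‖x‖ ≤ 1 := Iff.rfl

theorem charP_integerRing : CharP (integerRing L) p :=
  (integerRing L).subtype.charP Subtype.val_injective p

theorem perfectRing_integerRing : PerfectRing (integerRing L) p := by
  have := charP_integerRing p L
  apply PerfectRing.ofSurjective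
  rintro ⟨x, hx⟩
  obtain ⟨y, rfl⟩ := surjective_frobenius L p x
  refine ⟨⟨y, ?_⟩, rfl⟩
  rw [mem_integerRing]
  have hx : ‖y ^ p‖ ≤ 1 := hx
  rw [norm_pow] at hx
  exact (pow_le_one_iff_of_nonneg (norm_nonneg _) (Fact.out : p.Prime).ne_zero).1 hx

theorem algebraMap_mem_integerRing (k : Type*) [Field k] [Finite k] [Algebra k L] (c : k) :
    algebraMap k L c ∈ integerRing L := by
  rw [mem_integerRing]
  rcases eq_or_ne c 0 with rfl | hc
  · simp
  · obtain ⟨n, hn, h⟩ := (isOfFinOrder_of_finite (Units.mk0 c hc)).exists_pow_eq_one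
    have h1 : c ^ n = 1 := by simpa using congrArg Units.val h
    have h2 : ‖algebraMap k L c‖ ^ n = 1 := by rw [← norm_pow, ← map_pow, h1]; simp
    exact ((pow_eq_one_iff_of_nonneg (norm_nonneg _) hn.ne').1 h2).le

/-- A finite field contained in `L` is contained in the valuation ring of `L`. -/
noncomputable instance (priority := 50) algebraIntegerRing (k : Type*) [Field k] [Finite k]
    [Algebra k L] :
    Algebra k (integerRing L) :=
  ((algebraMap k L).codRestrict (integerRing L) (algebraMap_mem_integerRing L k)).toAlgebra

/-- The homomorphism `W(𝔬_L)_E → W(L)_E` induced by the inclusion of `𝔬_L` in `L`. -/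
noncomputable def inclWitt : RamWitt p O (integerRing L) →+* RamWitt p O L :=
  (Algebra.TensorProduct.map
    ({ WittVector.map (integerRing L).subtype with
        commutes' := fun w => by
          ext n
          exact (WittVector.map_coeff _ _ n) } :
      WittVector p (integerRing L) →ₐ[WittVector p (ResidueField O)] WittVector p L)
    (AlgHom.id (WittVector p (ResidueField O)) O)).toRingHom

theorem inclWitt_teich (a : integerRing L) :
    inclWitt p O L (teich p a) = teich p (a : L) := by
  refine (Algebra.TensorProduct.map_tmul _ _ _ _).trans ?_
  exact congrArg (fun w => w ⊗ₜ[WittVector p (ResidueField O)] (1 : O))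
    (WittVector.map_teichmuller p (integerRing L).subtype a)

theorem inclWitt_scal (c : O) :
    inclWitt p O L (scal p _ c) = scal p L c := by
  refine (Algebra.TensorProduct.map_tmul _ _ _ _).trans ?_
  rw [map_one]; rfl

/-- The ring `A_{L,E} = W(𝔬_L)_E[[x] : x ∈ L]`. -/
noncomputable def AInt : Subring (RamWitt p O L) :=
  Subring.closure (Set.range (inclWitt p O L) ∪ Set.range (teich p : L → RamWitt p O L))


section
variable {p O L} {ϖ : O} (hϖ : Irreducible ϖ)

theorem norm_digit_inclWitt_le (w : RamWitt p O (integerRing L)) (n : ℕ) :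
    ‖digit hϖ (inclWitt p O L w) n‖ ≤ 1 := by
  have := charP_integerRing p L
  have := perfectRing_integerRing p L
  induction n generalizing w with
  | zero =>
    obtain ⟨a, y, hy⟩ := exists_eq_teich_add hϖ w
    rw [digit_zero_of_eq hϖ (b := (a : L)) (y := inclWitt p O L y)
      (by rw [hy, map_add, map_mul, inclWitt_teich, inclWitt_scal])]
    exact a.2
  | succ n ih =>
    obtain ⟨a, y, hy⟩ := exists_eq_teich_add hϖ w
    rw [digit_succ_of_eq hϖ (b := (a : L)) (y := inclWitt p O L y)
      (by rw [hy, map_add, map_mul, inclWitt_teich, inclWitt_scal])]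
    exact ih y

theorem norm_digit_teich_add_teich_le {C : ℝ} {a b : L} (ha : ‖a‖ ≤ C) (hb : ‖b‖ ≤ C) (n : ℕ) :
    ‖digit hϖ (teich p a + teich p b : RamWitt p O L) n‖ ≤ C := by
  wlog hab : ‖b‖ ≤ ‖a‖ generalizing a b
  · rw [add_comm]; exact this hb ha (le_of_not_ge hab)
  rcases eq_or_ne a 0 with rfl | ha0
  · have hb0 : b = 0 := by simpa using hab
    rw [hb0, teich_zero, add_zero, digit_zero, norm_zero]
    exact (norm_nonneg _).trans hb
  · have hu : b / a ∈ integerRing L := by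
      rw [mem_integerRing, norm_div]
      exact div_le_one_of_le₀ hab (norm_nonneg _)
    have h : (teich p a + teich p b : RamWitt p O L) =
        teich p a * inclWitt p O L (1 + teich p ⟨b / a, hu⟩) := by
      rw [map_add, map_one, inclWitt_teich, mul_add, mul_one, ← teich_mul]
      simp only [mul_div_cancel₀ _ ha0]
    rw [h, digit_teich_mul, norm_mul]
    calc ‖a‖ * _ ≤ ‖a‖ * 1 := by gcongr; exact norm_digit_inclWitt_le hϖ _ n
      _ ≤ C := by rwa [mul_one]

theorem norm_digit_add_le (n : ℕ) : ∀ {c : ℕ → ℝ} (_ : Monotone c) {x y : RamWitt p O L}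
    (_ : ∀ m ≤ n, ‖digit hϖ x m‖ ≤ c m) (_ : ∀ m ≤ n, ‖digit hϖ y m‖ ≤ c m),
    ‖digit hϖ (x + y) n‖ ≤ c n := by
  induction n using Nat.strong_induction_on with
  | _ n ih =>
  intro c hc x y hx hy
  obtain ⟨x', hx', hxd⟩ := exists_tail hϖ x
  obtain ⟨y', hy', hyd⟩ := exists_tail hϖ y
  have hs := norm_digit_teich_add_teich_le (p := p) hϖ (hx 0 (Nat.zero_le _)) (hy 0 (Nat.zero_le _))
  obtain ⟨s', hs', hsd⟩ := exists_tail hϖ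
    (teich p (digit hϖ x 0) + teich p (digit hϖ y 0) : RamWitt p O L)
  set s : RamWitt p O L := teich p (digit hϖ x 0) + teich p (digit hϖ y 0) with hsdef
  have hsum : x + y = teich p (digit hϖ s 0) + scal p L ϖ * (s' + (x' + y')) := by
    calc x + y = s + scal p L ϖ * (x' + y') := by
          conv_lhs => rw [hx', hy']
          rw [hsdef]; ring
      _ = _ := by
          conv_lhs => rw [hs']
          ring
  cases n with
  | zero => rw [digit_zero_of_eq hϖ hsum]; exact hs 0
  | succ n =>
    rw [digit_succ_of_eq hϖ hsum]
    have hc' : Monotone fun m => c (m + 1) := fun a b hab => hc (by omega)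
    refine ih n (Nat.lt_succ_self n) hc' (fun m hm => ?_) (fun m hm => ?_)
    · rw [← hsd]; exact (hs _).trans (hc (Nat.zero_le _))
    · refine ih m (by omega) hc' (fun j hj => ?_) (fun j hj => ?_)
      · rw [← hxd]; exact hx _ (by omega)
      · rw [← hyd]; exact hy _ (by omega)

theorem norm_digit_mul_le (n : ℕ) : ∀ {c d e : ℕ → ℝ} (_ : Monotone e)
    (_ : ∀ i, 0 ≤ c i) (_ : ∀ i, 0 ≤ d i) (_ : ∀ i j, c i * d j ≤ e (i + j))
    {x y : RamWitt p O L}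
    (_ : ∀ m ≤ n, ‖digit hϖ x m‖ ≤ c m) (_ : ∀ m ≤ n, ‖digit hϖ y m‖ ≤ d m),
    ‖digit hϖ (x * y) n‖ ≤ e n := by
  induction n using Nat.strong_induction_on with
  | _ n ih =>
  intro c d e he hc hd hcd x y hx hy
  obtain ⟨x', hx', hxd⟩ := exists_tail hϖ x
  have hxy : x * y = teich p (digit hϖ x 0) * y + scal p L ϖ * (x' * y) := by
    conv_lhs => rw [hx']
    ring
  rw [hxy]
  refine norm_digit_add_le hϖ n he (fun m hm => ?_) (fun m hm => ?_)
  · rw [digit_teich_mul, norm_mul]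
    refine (mul_le_mul (hx 0 (Nat.zero_le _)) (hy m hm) (norm_nonneg _) (hc 0)).trans ?_
    simpa using hcd 0 m
  · cases m with
    | zero =>
      rw [digit_uniformizer_mul_zero, norm_zero]
      exact (mul_nonneg (hc 0) (hd 0)).trans (hcd 0 0)
    | succ m =>
      rw [digit_uniformizer_mul_succ]
      refine ih m (by omega) (c := fun i => c (i + 1)) (d := d) (e := fun i => e (i + 1))
        (fun a b hab => he (by omega)) (fun i => hc _) hd (fun i j => ?_) (fun j hj => ?_)
        (fun j hj => hy j (by omega))
      · have := hcd (i + 1) j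
        rwa [show i + 1 + j = i + j + 1 by omega] at this
      · rw [← hxd]; exact hx _ (by omega)

theorem norm_digit_neg_le (n : ℕ) {c : ℕ → ℝ} (hc : Monotone c) {x : RamWitt p O L}
    (hx : ∀ m ≤ n, ‖digit hϖ x m‖ ≤ c m) : ‖digit hϖ (-x) n‖ ≤ c n := by
  have h0 : 0 ≤ c 0 := (norm_nonneg _).trans (hx 0 (Nat.zero_le _))
  have h : -x = inclWitt p O L (-1) * x := by rw [map_neg, map_one, neg_one_mul]
  rw [h]
  refine norm_digit_mul_le hϖ n (c := fun _ => 1) (d := c) hc (fun _ => zero_le_one)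
    (fun i => h0.trans (hc (Nat.zero_le _))) (fun i j => ?_)
    (fun m _ => norm_digit_inclWitt_le hϖ _ m) hx
  rw [one_mul]; exact hc (by omega)

theorem exists_norm_digit_le {x : RamWitt p O L} (hx : x ∈ AInt p O L) :
    ∃ C : ℝ, ∀ n, ‖digit hϖ x n‖ ≤ C := by
  have hmono : ∀ C : ℝ, Monotone fun _ : ℕ => C := fun C => monotone_const
  induction hx using Subring.closure_induction with
  | mem x hx =>
    rcases hx with ⟨w, rfl⟩ | ⟨a, rfl⟩
    · exact ⟨1, norm_digit_inclWitt_le hϖ w⟩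
    · refine ⟨‖a‖, fun n => ?_⟩
      have h : (teich p a : RamWitt p O L) = teich p a * inclWitt p O L 1 := by
        rw [map_one, mul_one]
      rw [h, digit_teich_mul, norm_mul]
      exact mul_le_of_le_one_right (norm_nonneg _) (norm_digit_inclWitt_le hϖ _ n)
  | zero => exact ⟨0, fun n => by rw [digit_zero, norm_zero]⟩
  | one => exact ⟨1, fun n => by simpa using norm_digit_inclWitt_le (p := p) (L := L) hϖ 1 n⟩
  | add x y _ _ hx hy =>
    obtain ⟨C, hC⟩ := hx
    obtain ⟨D, hD⟩ := hy
    exact ⟨max C D, fun n => norm_digit_add_le hϖ n (hmono (max C D))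
      (fun m _ => (hC m).trans (le_max_left _ _)) (fun m _ => (hD m).trans (le_max_right _ _))⟩
  | neg x _ hx =>
    obtain ⟨C, hC⟩ := hx
    exact ⟨C, fun n => norm_digit_neg_le hϖ n (hmono C) fun m _ => hC m⟩
  | mul x y _ _ hx hy =>
    obtain ⟨C, hC⟩ := hx
    obtain ⟨D, hD⟩ := hy
    have h1 : 0 ≤ C := (norm_nonneg _).trans (hC 0)
    have h2 : 0 ≤ D := (norm_nonneg _).trans (hD 0)
    exact ⟨C * D, fun n => norm_digit_mul_le hϖ n (hmono (C * D)) (fun _ => h1) (fun _ => h2)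
      (fun _ _ => le_rfl) (fun m _ => hC m) (fun m _ => hD m)⟩

/-- The Gauss norm `λ_r (∑ ϖ ^ n [x n]) = max_n p ^ (-n) * |x n| ^ r`. On `A_{L,E}` the sequence
`x n` is bounded (`exists_norm_digit_le`), so the supremum is finite and is a maximum. -/
noncomputable def gaussNorm (r : ℝ) (x : RamWitt p O L) : ℝ :=
  ⨆ n : ℕ, (p : ℝ) ^ (-(n : ℤ)) * ‖digit hϖ x n‖ ^ r


theorem bddAbove_gauss {r : ℝ} (hr : 0 < r) {x : RamWitt p O L} (hx : x ∈ AInt p O L) :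
    BddAbove (Set.range fun n : ℕ => (p : ℝ) ^ (-(n : ℤ)) * ‖digit hϖ x n‖ ^ r) := by
  obtain ⟨C, hC⟩ := exists_norm_digit_le hϖ hx
  refine ⟨C ^ r, ?_⟩
  rintro _ ⟨n, rfl⟩
  have hp : (1 : ℝ) ≤ p := by exact_mod_cast (Fact.out : p.Prime).one_lt.le
  have h1 : (p : ℝ) ^ (-(n : ℤ)) ≤ 1 := by
    rw [zpow_neg, zpow_natCast]
    exact inv_le_one_of_one_le₀ (one_le_pow₀ hp)
  have h2 : ‖digit hϖ x n‖ ^ r ≤ C ^ r := Real.rpow_le_rpow (norm_nonneg _) (hC n) hr.le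
  have h3 : 0 ≤ ‖digit hϖ x n‖ ^ r := Real.rpow_nonneg (norm_nonneg _) _
  calc _ ≤ 1 * ‖digit hϖ x n‖ ^ r := mul_le_mul_of_nonneg_right h1 h3
    _ ≤ C ^ r := by rwa [one_mul]

theorem gaussNorm_nonneg (r : ℝ) (x : RamWitt p O L) : 0 ≤ gaussNorm hϖ r x :=
  Real.iSup_nonneg fun n => by positivity

/-- The bound on the `n`-th coefficient expressing `λ_r ≤ C`. -/
noncomputable def gaugeBound (p : ℕ) (r C : ℝ) (n : ℕ) : ℝ := (C * (p : ℝ) ^ n) ^ r⁻¹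

theorem gaugeBound_nonneg {r C : ℝ} (hC : 0 ≤ C) (n : ℕ) : 0 ≤ gaugeBound p r C n := by
  unfold gaugeBound; positivity

theorem gaugeBound_mono {r C : ℝ} (hr : 0 < r) (hC : 0 ≤ C) : Monotone (gaugeBound p r C) := by
  intro a b hab
  have hp : (1 : ℝ) ≤ p := by exact_mod_cast (Fact.out : p.Prime).one_lt.le
  unfold gaugeBound
  gcongr

theorem gaugeBound_mul {r C D : ℝ} (hC : 0 ≤ C) (hD : 0 ≤ D) (i j : ℕ) :
    gaugeBound p r C i * gaugeBound p r D j = gaugeBound p r (C * D) (i + j) := by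
  unfold gaugeBound
  rw [← Real.mul_rpow (by positivity) (by positivity)]
  congr 1
  ring

theorem term_le_iff {r C a : ℝ} (hr : 0 < r) (hC : 0 ≤ C) (ha : 0 ≤ a) (n : ℕ) :
    (p : ℝ) ^ (-(n : ℤ)) * a ^ r ≤ C ↔ a ≤ gaugeBound p r C n := by
  have hp : (0 : ℝ) < p := by exact_mod_cast (Fact.out : p.Prime).pos
  rw [zpow_neg, zpow_natCast, inv_mul_le_iff₀ (by positivity), gaugeBound, mul_comm,
    Real.le_rpow_inv_iff_of_pos ha (by positivity) hr]

theorem norm_digit_le_gauge {r : ℝ} (hr : 0 < r) {x : RamWitt p O L} (hx : x ∈ AInt p O L)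
    (n : ℕ) : ‖digit hϖ x n‖ ≤ gaugeBound p r (gaussNorm hϖ r x) n :=
  (term_le_iff hr (gaussNorm_nonneg hϖ r x) (norm_nonneg _) n).1
    (le_ciSup (bddAbove_gauss hϖ hr hx) n)

theorem gaussNorm_le {r C : ℝ} (hr : 0 < r) (hC : 0 ≤ C) {x : RamWitt p O L}
    (h : ∀ n, ‖digit hϖ x n‖ ≤ gaugeBound p r C n) : gaussNorm hϖ r x ≤ C :=
  ciSup_le fun n => (term_le_iff hr hC (norm_nonneg _) n).2 (h n)

theorem gaussNorm_add_le {r : ℝ} (hr : 0 < r) {x y : RamWitt p O L} (hx : x ∈ AInt p O L)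
    (hy : y ∈ AInt p O L) :
    gaussNorm hϖ r (x + y) ≤ max (gaussNorm hϖ r x) (gaussNorm hϖ r y) := by
  have hC : 0 ≤ max (gaussNorm hϖ r x) (gaussNorm hϖ r y) :=
    le_max_of_le_left (gaussNorm_nonneg hϖ r x)
  refine gaussNorm_le hϖ hr hC fun n => norm_digit_add_le hϖ n (gaugeBound_mono hr hC)
    (fun m _ => ?_) (fun m _ => ?_)
  · rw [← term_le_iff hr hC (norm_nonneg _)]
    exact (le_ciSup (bddAbove_gauss hϖ hr hx) m).trans (le_max_left _ _)
  · rw [← term_le_iff hr hC (norm_nonneg _)]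
    exact (le_ciSup (bddAbove_gauss hϖ hr hy) m).trans (le_max_right _ _)

theorem gaussNorm_mul_le {r : ℝ} (hr : 0 < r) {x y : RamWitt p O L} (hx : x ∈ AInt p O L)
    (hy : y ∈ AInt p O L) :
    gaussNorm hϖ r (x * y) ≤ gaussNorm hϖ r x * gaussNorm hϖ r y := by
  have h1 := gaussNorm_nonneg hϖ r x
  have h2 := gaussNorm_nonneg hϖ r y
  exact gaussNorm_le hϖ hr (mul_nonneg h1 h2) fun n =>
    norm_digit_mul_le hϖ n (gaugeBound_mono hr (mul_nonneg h1 h2))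
      (fun i => gaugeBound_nonneg h1 i) (fun i => gaugeBound_nonneg h2 i)
      (fun i j => (gaugeBound_mul h1 h2 i j).le)
      (fun m _ => norm_digit_le_gauge hϖ hr hx m) (fun m _ => norm_digit_le_gauge hϖ hr hy m)

theorem gaussNorm_neg_le {r : ℝ} (hr : 0 < r) {x : RamWitt p O L} (hx : x ∈ AInt p O L) :
    gaussNorm hϖ r (-x) ≤ gaussNorm hϖ r x := by
  have h1 := gaussNorm_nonneg hϖ r x
  exact gaussNorm_le hϖ hr h1 fun n => norm_digit_neg_le hϖ n (gaugeBound_mono hr h1)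
    fun m _ => norm_digit_le_gauge hϖ hr hx m

theorem gaussNorm_zero {r : ℝ} (hr : 0 < r) : gaussNorm hϖ r (0 : RamWitt p O L) = 0 := by
  simp [gaussNorm, digit_zero, Real.zero_rpow hr.ne']

variable (p L) in
/-- The Gauss norm `λ_r` on `A_{L,E}`, for `r > 0`. -/
noncomputable def gaussRingSeminorm {r : ℝ} (hr : 0 < r) : RingSeminorm (AInt p O L) where
  toFun x := gaussNorm hϖ r (x : RamWitt p O L)
  map_zero' := gaussNorm_zero hϖ hr
  add_le' x y := (gaussNorm_add_le hϖ hr x.2 y.2).trans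
    (max_le_add_of_nonneg (gaussNorm_nonneg _ _ _) (gaussNorm_nonneg _ _ _))
  neg' x := le_antisymm (gaussNorm_neg_le hϖ hr x.2) (by
    simpa using gaussNorm_neg_le hϖ hr (-x).2)
  mul_le' x y := gaussNorm_mul_le hϖ hr x.2 y.2

variable (p L) in
/-- A copy of the ring `A_{L,E}`, to carry the norm `λ_r`. -/
def GaussAInt {ϖ : O} (_ : Irreducible ϖ) {r : ℝ} (_ : 0 < r) : Type _ := AInt p O L

noncomputable instance {r : ℝ} (hr : 0 < r) : CommRing (GaussAInt p L hϖ hr) :=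
  inferInstanceAs (CommRing (AInt p O L))

noncomputable instance {r : ℝ} (hr : 0 < r) : SeminormedCommRing (GaussAInt p L hϖ hr) :=
  { (gaussRingSeminorm p L hϖ hr).toSeminormedRing with
    mul_comm := mul_comm }

theorem norm_gaussAInt {r : ℝ} (hr : 0 < r) (x : AInt p O L) :
    ‖(show GaussAInt p L hϖ hr from x)‖ =
      ⨆ n : ℕ, (p : ℝ) ^ (-(n : ℤ)) * ‖digit hϖ (x : RamWitt p O L) n‖ ^ r := rfl

instance {r : ℝ} (hr : 0 < r) : IsUltrametricDist (GaussAInt p L hϖ hr) :=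
  IsUltrametricDist.isUltrametricDist_of_forall_norm_add_le_max_norm
    fun x y => gaussNorm_add_le hϖ hr x.2 y.2

variable (p L) in
/-- The Banach ring `A^r_{L,E}`: the completion of `A_{L,E}` with respect to `λ_r`. -/
abbrev RobbaInt {r : ℝ} (hr : 0 < r) : Type _ :=
  UniformSpace.Completion (GaussAInt p L hϖ hr)

instance {r : ℝ} (hr : 0 < r) : IsUltrametricDist (RobbaInt p L hϖ hr) := by
  refine ⟨fun x y z => ?_⟩
  induction x, y, z using UniformSpace.Completion.induction_on₃ with
  | hp => exact isClosed_le (by fun_prop) (by fun_prop)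
  | ih x y z =>
    simp only [UniformSpace.Completion.dist_eq]
    exact dist_triangle_max x y z

end

end Gauss

/-- The weighted Tate algebra `A{T_1/ρ_1, …, T_n/ρ_n}` over a nonarchimedean normed ring `A`
(complete in the intended use): the power series `∑ c_I T ^ I` with
`‖c_I‖ ρ_1 ^ i_1 ⋯ ρ_n ^ i_n → 0`, as `I` runs through the cofinite filter. -/
noncomputable abbrev weightedTate (A : Type*) [NormedCommRing A] [IsUltrametricDist A] {n : ℕ}
    (ρ : Fin n → ℝ) : Subring (MvPowerSeries (Fin n) A) :=
  MvPowerSeries.IsRestricted.subring ρ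

section DVF
variable (E : Type*) [NontriviallyNormedField E] [IsUltrametricDist E] [CompleteSpace E]
  [IsDiscreteValuationRing (integerRing E)]

/-- The valuation ring of a complete discretely valued field is complete for the topology defined
by its maximal ideal. -/
instance : IsAdicComplete (maximalIdeal (integerRing E)) (integerRing E) := by
  obtain ⟨ϖ, hϖ⟩ := IsDiscreteValuationRing.exists_irreducible (integerRing E)
  have hϖ0 : (ϖ : E) ≠ 0 := fun h => hϖ.ne_zero (Subtype.ext h)
  have hlt : ‖(ϖ : E)‖ < 1 := by
    refine lt_of_le_of_ne ϖ.2 fun h => hϖ.not_isUnit ?_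
    have hinv : (ϖ : E)⁻¹ ∈ integerRing E := by
      rw [mem_integerRing, norm_inv, h, inv_one]
    exact IsUnit.of_mul_eq_one ⟨_, hinv⟩ (Subtype.ext (mul_inv_cancel₀ hϖ0))
  have hmem : ∀ (n : ℕ) (x : integerRing E),
      x ∈ maximalIdeal (integerRing E) ^ n ↔ ‖(x : E)‖ ≤ ‖(ϖ : E)‖ ^ n := by
    intro n x
    rw [hϖ.maximalIdeal_eq, Ideal.span_singleton_pow, Ideal.mem_span_singleton, ← norm_pow]
    constructor
    · rintro ⟨y, rfl⟩
      have hy : ‖(y : E)‖ ≤ 1 := y.2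
      calc ‖((ϖ ^ n * y : integerRing E) : E)‖ = ‖(ϖ : E) ^ n‖ * ‖(y : E)‖ := norm_mul _ _
        _ ≤ _ := mul_le_of_le_one_right (norm_nonneg _) hy
    · intro h
      have hq : (x : E) / (ϖ : E) ^ n ∈ integerRing E := by
        rw [mem_integerRing, norm_div]
        exact div_le_one_of_le₀ h (norm_nonneg _)
      exact ⟨⟨_, hq⟩, Subtype.ext (mul_div_cancel₀ _ (pow_ne_zero n hϖ0)).symm⟩
  exact
  { prec' := by
      intro f hf
      simp only [smul_eq_mul, Ideal.mul_top, SModEq.sub_mem] at hf ⊢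
      have hf' : ∀ {m n : ℕ}, m ≤ n → ‖(f m : E) - f n‖ ≤ ‖(ϖ : E)‖ ^ m :=
        fun h => (hmem _ _).1 (hf h)
      have hc : CauchySeq fun n => (f n : E) :=
        cauchySeq_of_le_geometric (‖(ϖ : E)‖) 1 hlt fun n => by
          rw [one_mul, dist_eq_norm]; exact hf' (Nat.le_succ n)
      obtain ⟨l, hl⟩ := cauchySeq_tendsto_of_complete hc
      have hl1 : l ∈ integerRing E :=
        mem_integerRing.2 (le_of_tendsto hl.norm (Filter.Eventually.of_forall fun n => (f n).2))
      refine ⟨⟨l, hl1⟩, fun n => (hmem _ _).2 ?_⟩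
      exact le_of_tendsto ((tendsto_const_nhds (x := (f n : E))).sub hl).norm
        (Filter.eventually_atTop.2 ⟨n, fun m hm => hf' hm⟩) }

end DVF

end Robba

namespace Robba

open IsLocalRing Filter Topology

set_option linter.unusedSectionVars false

/-! The argument is Gröbner-basis theory in the variables T_1, …, T_n and ϖ over the field L.
Elements of A_{L,E} are series in ϖ with Teichmüller coefficients, so elements of the Tate algebra
are treated as series of terms [a] ϖ^k T^I indexed by ℕ^n × ℕ, where ϖ has weight p⁻¹. Two things
prevent this from being literal. Teichmüller expansions are not additive; but the carries move at
least one place up and therefore lose a factor p⁻¹ in the Gauss norm (`norm_digit_add_sub_le`). And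
the coefficients of a series lie in a completion; they are replaced by approximations in A_{L,E}
with relative error p⁻¹ (`approxCoeff`). Multiplication by a monomial, on the other hand, shifts and
scales digits exactly. `ApproxExpansion` records what survives: expansions valid up to a relative
error θ < 1.

This is enough for division. A nonzero f has only finitely many terms of maximal size; its lead is
the largest of their indices in a lexicographic order. If the lead of g divides that of f, a
monomial multiple of g cancels it, because L is a field. The terms of g above its lead are smaller
than its norm by a fixed factor ε < 1 (`IsLead.exists_gap`), so the terms of f above the cancelled
one change only negligibly (`exists_cancel`). Hence the finite multiset of indices of non-negligible
terms decreases in the Dershowitz–Manna order, and after finitely many cancellations the remainder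
is smaller by the factor ε (`exists_division`). Iterating, the quotients converge and the remainder
tends to 0 (`eq_span_of_division`). By Dickson's lemma, finitely many elements of an ideal have
leads dividing all leads of the ideal, and these elements generate it. -/

/-- Approximate expansions of the elements of a ring `R` in monomials indexed by `M`, with
coefficients in a valued field `L`. The expansion of `f` is only meaningful up to an error of size
`θ * N f`; up to such errors it is additive and compatible with multiplication by monomials. -/
structure ApproxExpansion (M L R : Type*) [AddCommMonoid M] [Field L] [CommRing R] where
  /-- the absolute value on coefficients -/
  v : AbsoluteValue L ℝ
  v_add : IsNonarchimedean v
  /-- the sizes of the monomials -/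
  w : M → ℝ
  w_pos : ∀ J, 0 < w J
  w_add : ∀ J K, w (J + K) = w J * w K
  /-- the norm of the ring -/
  N : RingNorm R
  N_add : IsNonarchimedean N
  -- Completeness comes with an explicit bound on the tails: in the ultrametric setting the error
  -- after S terms is bounded by the first omitted bound.
  complete : ∀ (a : ℕ → R) (b : ℕ → ℝ), Antitone b → Filter.Tendsto b Filter.atTop (nhds 0) →
    (∀ s, N (a s) ≤ b s) → ∃ x, ∀ S, N (x - ∑ s ∈ Finset.range S, a s) ≤ b S
  /-- the relative precision of the expansions -/
  θ : ℝ
  θ_nonneg : 0 ≤ θ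
  θ_lt : θ < 1
  /-- the coefficients of the expansions -/
  c : R → M → L
  finite : ∀ f, {J | θ * N f < w J * v (c f J)}.Finite
  le : ∀ f J, w J * v (c f J) ≤ N f
  exists_eq : ∀ f, f ≠ 0 → ∃ J, w J * v (c f J) = N f
  add : ∀ f g J, w J * v (c (f + g) J - (c f J + c g J)) ≤ θ * max (N f) (N g)
  -- The last clause says that indices which are not translates by K carry only negligible terms of
  -- the product.
  monomial : ∀ (a : L) (K : M), ∃ m : R, ∀ f, N (m * f) ≤ v a * w K * N f ∧
    (∀ J, w (J + K) * v (c (m * f) (J + K) - a * c f J) ≤ θ * (v a * w K * N f)) ∧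
    ∀ J, (∀ J', J ≠ J' + K) → w J * v (c (m * f) J) ≤ θ * (v a * w K * N f)

/-! ### Generators of an ideal from division with small remainder -/

namespace ApproxExpansion

variable {M L R : Type*} [AddCommMonoid M] [Field L] [CommRing R] (X : ApproxExpansion M L R)

/-- The size of the term of index `J` in the expansion of `f`. -/
noncomputable def size (f : R) (J : M) : ℝ := X.w J * X.v (X.c f J)

theorem N_pos {f : R} (hf : f ≠ 0) : 0 < X.N f :=
  lt_of_le_of_ne (apply_nonneg X.N f) fun h => hf (X.N.eq_zero_of_map_eq_zero' f h.symm)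

theorem size_le_of_sub {f : R} {J : M} {x : L} {C : ℝ} (h1 : X.w J * X.v (X.c f J - x) ≤ C)
    (h2 : X.w J * X.v x ≤ C) : X.size f J ≤ C := by
  have h : X.v (X.c f J) ≤ max (X.v (X.c f J - x)) (X.v x) := by
    simpa using X.v_add (X.c f J - x) x
  calc X.size f J ≤ X.w J * max (X.v (X.c f J - x)) (X.v x) :=
        mul_le_mul_of_nonneg_left h (X.w_pos J).le
    _ ≤ C := by rw [mul_max_of_nonneg _ _ (X.w_pos J).le]; exact max_le h1 h2

theorem w_mul_add_le {J : M} {x y : L} {C : ℝ} (h1 : X.w J * X.v x ≤ C)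
    (h2 : X.w J * X.v y ≤ C) : X.w J * X.v (x + y) ≤ C := by
  calc _ ≤ X.w J * max (X.v x) (X.v y) :=
        mul_le_mul_of_nonneg_left (X.v_add _ _) (X.w_pos J).le
    _ ≤ C := by rw [mul_max_of_nonneg _ _ (X.w_pos J).le]; exact max_le h1 h2

theorem finite_size_gt {f : R} {C : ℝ} (hC : X.θ * X.N f ≤ C) : {J | C < X.size f J}.Finite :=
  (X.finite f).subset fun _ hJ => hC.trans_lt hJ

theorem N_sum_le {ι : Type*} (s : Finset ι) (f : ι → R) {C : ℝ} (hC : 0 ≤ C)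
    (h : ∀ i ∈ s, X.N (f i) ≤ C) : X.N (∑ i ∈ s, f i) ≤ C := by
  classical
  induction s using Finset.induction_on with
  | empty => simpa using hC
  | insert i s hi ih =>
    rw [Finset.sum_insert hi]
    exact (X.N_add _ _).trans (max_le (h i (Finset.mem_insert_self _ _))
      (ih fun j hj => h j (Finset.mem_insert_of_mem hj)))

/-- If every element of an ideal can be divided by a finite set of elements of the ideal with a
remainder smaller by a fixed factor, then the finite set generates the ideal. -/
theorem eq_span_of_division {I : Ideal R} {F : Finset R} {ε κ : ℝ} (hε0 : 0 ≤ ε) (hε : ε < 1)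
    (hκ0 : 0 ≤ κ) (hFI : ∀ g ∈ F, g ∈ I)
    (hdiv : ∀ C : ℝ, 0 ≤ C → ∀ f ∈ I, X.N f ≤ C →
      ∃ a : R → R, (∀ g ∈ F, X.N (a g) ≤ κ * C) ∧ X.N (f - ∑ g ∈ F, a g * g) ≤ ε * C) :
    I = Ideal.span F := by
  refine le_antisymm (fun f hf => ?_) (Ideal.span_le.2 hFI)
  set D := X.N f with hD
  have hD0 : 0 ≤ D := apply_nonneg _ _
  -- The size condition is a premise after the existential, so that `choose` yields quotients
  -- defined for all s and f.
  have hstep : ∀ (s : ℕ) (f : {f : R // f ∈ I}), ∃ a : R → R, X.N f ≤ ε ^ s * D →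
      (∀ g ∈ F, X.N (a g) ≤ κ * (ε ^ s * D)) ∧
        X.N (f - ∑ g ∈ F, a g * g) ≤ ε ^ (s + 1) * D := by
    intro s f
    by_cases h : X.N f ≤ ε ^ s * D
    · obtain ⟨a, ha⟩ := hdiv (ε ^ s * D) (by positivity) f f.2 h
      exact ⟨a, fun _ => ⟨ha.1, by rw [pow_succ']; simpa [mul_assoc] using ha.2⟩⟩
    · exact ⟨0, fun h' => absurd h' h⟩
  choose a ha using hstep
  -- The successive remainders, kept together with their membership in I so that each can be divided
  -- again.
  let u : ℕ → {f : R // f ∈ I} := fun s => Nat.rec ⟨f, hf⟩ (fun s f => ⟨f - ∑ g ∈ F, a s f g * g,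
    I.sub_mem f.2 (I.sum_mem fun g hg => I.mul_mem_left _ (hFI g hg))⟩) s
  have hu1 : ∀ s : ℕ, (u (s + 1)).1 = (u s).1 - ∑ g ∈ F, a s (u s) g * g := fun s => rfl
  have hu : ∀ s, X.N (u s).1 ≤ ε ^ s * D := by
    intro s
    induction s with
    | zero => simp [u, hD]
    | succ s ih => rw [hu1]; exact (ha s (u s) ih).2
  have hua : ∀ S, (u S).1 = f - ∑ g ∈ F, (∑ s ∈ Finset.range S, a s (u s) g) * g := by
    intro S
    induction S with
    | zero => simp [u]
    | succ S ih =>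
      rw [hu1]
      simp only [Finset.sum_range_succ, add_mul, Finset.sum_add_distrib]
      rw [← sub_sub, ← ih]
  have hanti : Antitone fun s : ℕ => κ * (ε ^ s * D) := fun i j hij => by
    have := pow_le_pow_of_le_one hε0 hε.le hij
    dsimp only
    gcongr
  have hpow : Filter.Tendsto (fun s : ℕ => ε ^ s * D) Filter.atTop (nhds 0) := by
    simpa using (tendsto_pow_atTop_nhds_zero_of_lt_one hε0 hε).mul_const D
  have hlim : Filter.Tendsto (fun s : ℕ => κ * (ε ^ s * D)) Filter.atTop (nhds 0) := by
    simpa using hpow.const_mul κ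
  have hex : ∀ g, ∃ x, g ∈ F → ∀ S, X.N (x - ∑ s ∈ Finset.range S, a s (u s) g) ≤
      κ * (ε ^ S * D) := by
    intro g
    by_cases hg : g ∈ F
    · obtain ⟨x, hx⟩ := X.complete (fun s => a s (u s) g) _ hanti hlim
        fun s => (ha s (u s) (hu s)).1 g hg
      exact ⟨x, fun _ => hx⟩
    · exact ⟨0, fun h => absurd h hg⟩
  choose x hx using hex
  obtain ⟨B, hB0, hB⟩ : ∃ B : ℝ, 0 ≤ B ∧ ∀ g ∈ F, X.N g ≤ B :=
    ⟨∑ g ∈ F, X.N g, Finset.sum_nonneg fun _ _ => apply_nonneg _ _, fun g hg =>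
      Finset.single_le_sum (f := fun g => X.N g) (fun _ _ => apply_nonneg _ _) hg⟩
  have hfx : X.N (f - ∑ g ∈ F, x g * g) ≤ 0 := by
    -- For every S this difference is the S-th remainder minus the tails of the quotient series
    -- times the generators; both contributions tend to 0 with S.
    have hle : ∀ S, X.N (f - ∑ g ∈ F, x g * g) ≤ max (ε ^ S * D) (κ * (ε ^ S * D) * B) := by
      intro S
      have h1 : f - ∑ g ∈ F, x g * g =
          (u S).1 + -∑ g ∈ F, (x g - ∑ s ∈ Finset.range S, a s (u s) g) * g := by
        rw [hua]
        simp only [sub_mul, Finset.sum_sub_distrib]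
        ring
      rw [h1]
      refine (X.N_add _ _).trans (max_le_max (hu S) ?_)
      rw [map_neg_eq_map]
      refine X.N_sum_le _ _ (by positivity) fun g hg => (map_mul_le_mul X.N _ _).trans ?_
      exact mul_le_mul (hx g hg S) (hB g hg) (apply_nonneg _ _) (by positivity)
    have hlim' : Filter.Tendsto (fun S : ℕ => max (ε ^ S * D) (κ * (ε ^ S * D) * B))
        Filter.atTop (nhds 0) := by
      simpa using hpow.max (hlim.mul_const B)
    exact ge_of_tendsto' hlim' hle
  have h0 := X.N.eq_zero_of_map_eq_zero' _ (le_antisymm hfx (apply_nonneg X.N _))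
  rw [sub_eq_zero.1 h0]
  exact Ideal.sum_mem _ fun g hg => Ideal.mul_mem_left _ _ (Ideal.subset_span hg)

/-! ### Leading terms and the division algorithm -/

section Order
variable [LinearOrder M]

/-- `J` is the largest index of a term of `f` of maximal size. -/
def IsLead (f : R) (J : M) : Prop := X.size f J = X.N f ∧ ∀ J' > J, X.size f J' < X.N f

/-- Since θ < 1, terms of size N f lie above the threshold θ N f, so there are finitely many of
them, and the maximum is attained by `exists_eq`. -/
theorem exists_isLead {f : R} (hf : f ≠ 0) : ∃ J, X.IsLead f J := by
  have hpos := X.N_pos hf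
  have hfin : {J | X.size f J = X.N f}.Finite := by
    refine (X.finite f).subset fun J hJ => ?_
    change X.θ * X.N f < X.size f J
    rw [show X.size f J = X.N f from hJ]
    nlinarith [X.θ_lt]
  obtain ⟨J, hJ, hmax⟩ := hfin.exists_maximal (X.exists_eq f hf)
  refine ⟨J, hJ, fun J' hJ' => lt_of_le_of_ne (X.le f J') fun h => ?_⟩
  exact absurd (hmax h hJ'.le) (not_le.2 hJ')

/-- Above J, only finitely many terms exceed θ N f, and each is strictly smaller than N f. The
largest of θ and their ratios to N f is therefore still below 1. This is what turns strict
inequality at the lead into a uniform contraction factor. -/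
theorem IsLead.exists_gap {f : R} {J : M} (hf : f ≠ 0) (h : X.IsLead f J) :
    ∃ ε < 1, ∀ J' > J, X.size f J' ≤ ε * X.N f := by
  classical
  have hpos := X.N_pos hf
  let s : Finset ℝ := insert X.θ
    (((X.finite f).toFinset.filter (J < ·)).image fun J' => X.size f J' / X.N f)
  have hs : s.Nonempty := Finset.insert_nonempty _ _
  refine ⟨s.max' hs, ?_, fun J' hJ' => ?_⟩
  · rw [Finset.max'_lt_iff]
    intro y hy
    rcases Finset.mem_insert.1 hy with rfl | hy
    · exact X.θ_lt
    · obtain ⟨J', hJ', rfl⟩ := Finset.mem_image.1 hy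
      rw [div_lt_one hpos]
      exact h.2 J' (Finset.mem_filter.1 hJ').2
  · by_cases h1 : X.θ * X.N f < X.size f J'
    · rw [← div_le_iff₀ hpos]
      refine Finset.le_max' s _ (Finset.mem_insert_of_mem (Finset.mem_image.2 ⟨J', ?_, rfl⟩))
      exact Finset.mem_filter.2 ⟨(X.finite f).mem_toFinset.2 h1, hJ'⟩
    · refine (not_lt.1 h1).trans ?_
      gcongr
      exact Finset.le_max' _ _ (Finset.mem_insert_self _ _)

variable [IsOrderedCancelAddMonoid M]

/-- One step of the division algorithm: the leading term of `f` is cancelled by a multiple of `g`,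
and the terms of higher index are not affected. -/
theorem exists_cancel {f g : R} {Jg K : M} {ε : ℝ} (hf : f ≠ 0) (hg : g ≠ 0)
    (hθ : X.θ ≤ ε) (hJg : X.size g Jg = X.N g) (hgap : ∀ J' > Jg, X.size g J' ≤ ε * X.N g)
    (hlead : X.IsLead f (Jg + K)) :
    ∃ m : R, X.N (m * g) ≤ X.N f ∧ X.N m ≤ X.N 1 / X.N g * X.N f ∧
      X.size (f + m * g) (Jg + K) ≤ ε * X.N f ∧
      ∀ J > Jg + K, X.w J * X.v (X.c (f + m * g) J - X.c f J) ≤ ε * X.N f := by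
  have hfp := X.N_pos hf
  have hgp := X.N_pos hg
  have hc : X.c g Jg ≠ 0 := by
    intro h0
    rw [size, h0, map_zero, mul_zero] at hJg
    exact hgp.ne hJg
  have hθf : X.θ * X.N f ≤ ε * X.N f := by gcongr
  -- With this coefficient the monomial multiple of g has at Jg + K the opposite of the leading
  -- coefficient of f, and its norm bound is exactly N f.
  set b : L := -(X.c f (Jg + K) / X.c g Jg) with hb
  have hbw : X.v b * X.w K * X.N g = X.N f := by
    have h1 : X.w (Jg + K) * X.v (X.c f (Jg + K)) = X.N f := hlead.1
    have h2 : X.v (X.c g Jg) ≠ 0 := by simpa using hc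
    rw [← hJg, ← h1, size, hb, X.v.map_neg, map_div₀, X.w_add]
    field_simp
  obtain ⟨m, hm⟩ := X.monomial b K
  obtain ⟨h1, h2, h3⟩ := hm g
  rw [hbw] at h1 h2 h3
  have hadd : ∀ J, X.w J * X.v (X.c (f + m * g) J - (X.c f J + X.c (m * g) J)) ≤ ε * X.N f := by
    intro J
    refine (X.add f (m * g) J).trans ?_
    rwa [max_eq_left h1]
  refine ⟨m, h1, ?_, ?_, fun J hJ => ?_⟩
  -- The norm of the monomial itself is bounded by applying its multiplication bound to 1.
  · have := (hm 1).1
    rw [mul_one] at this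
    refine this.trans (le_of_eq ?_)
    rw [← hbw]; field_simp
  · refine X.size_le_of_sub (hadd _) ?_
    have : X.c f (Jg + K) + X.c (m * g) (Jg + K) = X.c (m * g) (Jg + K) - b * X.c g Jg := by
      rw [hb]; field_simp; ring
    rw [this]
    exact (h2 Jg).trans hθf
  · have : X.c (f + m * g) J - X.c f J =
      (X.c (f + m * g) J - (X.c f J + X.c (m * g) J)) + X.c (m * g) J := by ring
    rw [this]
    refine X.w_mul_add_le (hadd J) ?_
    -- A translate J' + K above the lead comes from J' > Jg, where the gap of g applies; at any
    -- other index the product has only a negligible term.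
    by_cases hJK : ∃ J', J = J' + K
    · obtain ⟨J', rfl⟩ := hJK
      refine X.size_le_of_sub ((h2 J').trans hθf) ?_
      have hlt : Jg < J' := lt_of_add_lt_add_right hJ
      rw [map_mul, X.w_add]
      calc X.w J' * X.w K * (X.v b * X.v (X.c g J')) = X.v b * X.w K * X.size g J' := by
            rw [size]; ring
        _ ≤ X.v b * X.w K * (ε * X.N g) :=
            mul_le_mul_of_nonneg_left (hgap _ hlt) (mul_nonneg (apply_nonneg _ _) (X.w_pos _).le)
        _ = ε * X.N f := by rw [← hbw]; ring
    · push Not at hJK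
      exact (h3 J hJK).trans hθf

variable [WellFoundedLT M]

/-- Division of `f` by a finite set `F` with remainder of norm at most `ε * C`. -/
theorem exists_division {I : Ideal R} {F : Finset R} {ld : R → M} {ε κ : ℝ}
    (hθ : X.θ ≤ ε) (hFI : ∀ g ∈ F, g ∈ I) (hF0 : ∀ g ∈ F, g ≠ 0)
    (hld : ∀ g ∈ F, X.size g (ld g) = X.N g)
    (hgap : ∀ g ∈ F, ∀ J' > ld g, X.size g J' ≤ ε * X.N g)
    (hκ : ∀ g ∈ F, X.N 1 / X.N g ≤ κ) (hκ0 : 0 ≤ κ)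
    (hF : ∀ f ∈ I, f ≠ 0 → ∀ J, X.IsLead f J → ∃ g ∈ F, ∃ K, J = ld g + K)
    {C : ℝ} (hC : 0 ≤ C) {f : R} (hf : f ∈ I) (hfC : X.N f ≤ C) :
    ∃ a : R → R, (∀ g ∈ F, X.N (a g) ≤ κ * C) ∧ X.N (f - ∑ g ∈ F, a g * g) ≤ ε * C := by
  classical
  have hε0 : 0 ≤ ε := X.θ_nonneg.trans hθ
  have hfin : ∀ f, X.N f ≤ C → {J | ε * C < X.size f J}.Finite := fun f hfC =>
    X.finite_size_gt (mul_le_mul hθ hfC (apply_nonneg _ _) hε0)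
  -- The induction is on the set of indices whose terms exceed ε C, viewed as a multiset. The
  -- threshold is fixed by C, not by N f, so it does not move when f is replaced by f + m g.
  suffices H : ∀ (s : Multiset M) (f : R), f ∈ I → ∀ hfC : X.N f ≤ C,
      (hfin f hfC).toFinset.val = s →
      ∃ a : R → R, (∀ g ∈ F, X.N (a g) ≤ κ * C) ∧ X.N (f - ∑ g ∈ F, a g * g) ≤ ε * C from
    H _ f hf hfC rfl
  intro s
  induction s using (Multiset.wellFounded_isDershowitzMannaLT (α := M)).induction with
  | _ s ih =>
  intro f hf hfC hs
  rcases le_or_gt (X.N f) (ε * C) with hsmall | hbig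
  · exact ⟨fun _ => 0, fun g _ => by rw [map_zero]; positivity, by simpa using hsmall⟩
  have hf0 : f ≠ 0 := by
    rintro rfl
    rw [map_zero] at hbig
    exact absurd hbig (not_lt.2 (by positivity))
  obtain ⟨J, hJ⟩ := X.exists_isLead hf0
  obtain ⟨g, hgF, K, rfl⟩ := hF f hf hf0 J hJ
  obtain ⟨m, hm1, hm2, hm3, hm4⟩ :=
    X.exists_cancel hf0 (hF0 g hgF) hθ (hld g hgF) (hgap g hgF) hJ
  have hεf : ε * X.N f ≤ ε * C := by gcongr
  have hf1C : X.N (f + m * g) ≤ C := (X.N_add _ _).trans (max_le hfC (hm1.trans hfC))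
  have hf1I : f + m * g ∈ I := I.add_mem hf (I.mul_mem_left _ (hFI g hgF))
  have hlt : Multiset.IsDershowitzMannaLT (hfin _ hf1C).toFinset.val s := by
    set S := (hfin f hfC).toFinset with hS
    set S' := (hfin _ hf1C).toFinset with hS'
    set J := ld g + K
    have hsplit : ∀ T : Finset M,
        T.val = (T.filter (J < ·)).val + (T.filter fun j => ¬ J < j).val := fun T => by
      rw [Finset.filter_val, Finset.filter_val, Multiset.filter_add_not]
    -- Above J the coefficients of f and f + m g differ by a term of size at most ε C, so by the
    -- ultrametric inequality they exceed ε C simultaneously.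
    have htop : S'.filter (J < ·) = S.filter (J < ·) := by
      ext j
      simp only [Finset.mem_filter, and_congr_left_iff]
      intro hj
      have h4 := (hm4 j hj).trans hεf
      rw [hS, hS', Set.Finite.mem_toFinset, Set.Finite.mem_toFinset, Set.mem_ofPred_eq,
        Set.mem_ofPred_eq]
      rw [← not_iff_not, not_lt, not_lt]
      constructor
      · intro h
        have := X.w_mul_add_le (x := X.c f j - X.c (f + m * g) j) (y := X.c (f + m * g) j)
          (by rwa [AbsoluteValue.map_sub]) h
        rwa [sub_add_cancel] at this
      · exact fun h => X.size_le_of_sub h4 h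
    -- The common part consists of the indices above J. Of the rest, J disappears, since its term is
    -- now at most ε C, and any indices that appear are smaller than J.
    refine ⟨(S.filter (J < ·)).val, (S'.filter fun j => ¬ J < j).val,
      (S.filter fun j => ¬ J < j).val, ?_, ?_, ?_, ?_⟩
    · have : J ∈ (S.filter fun j => ¬ J < j).val := by
        rw [Finset.mem_val, Finset.mem_filter]
        refine ⟨(hfin f hfC).mem_toFinset.2 ?_, lt_irrefl _⟩
        rw [Set.mem_ofPred_eq, hJ.1]; exact hbig
      intro h
      rw [h] at this
      exact absurd this (Multiset.notMem_zero _)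
    · rw [← htop]; exact hsplit S'
    · rw [← hs]; exact hsplit S
    · intro y hy
      rw [Finset.mem_val, Finset.mem_filter] at hy
      refine ⟨J, ?_, ?_⟩
      · rw [Finset.mem_val, Finset.mem_filter]
        refine ⟨(hfin f hfC).mem_toFinset.2 ?_, lt_irrefl _⟩
        rw [Set.mem_ofPred_eq, hJ.1]; exact hbig
      · refine lt_of_le_of_ne (not_lt.1 hy.2) ?_
        rintro rfl
        exact absurd ((hfin _ hf1C).mem_toFinset.1 hy.1) (not_lt.2 (hm3.trans hεf))
  obtain ⟨a, ha1, ha2⟩ := ih _ hlt (f + m * g) hf1I hf1C rfl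
  -- Dividing f + m g instead of f changes only the quotient at g, by m.
  refine ⟨fun h => a h - if h = g then m else 0, fun h hh => ?_, ?_⟩
  · dsimp only
    rw [sub_eq_add_neg]
    refine (X.N_add _ _).trans (max_le (ha1 h hh) ?_)
    rw [map_neg_eq_map]
    split_ifs with h'
    · exact hm2.trans (mul_le_mul (hκ g hgF) hfC (apply_nonneg _ _) hκ0)
    · rw [map_zero]; positivity
  · have : f - ∑ h ∈ F, (a h - if h = g then m else 0) * h =
        f + m * g - ∑ h ∈ F, a h * h := by
      simp only [sub_mul, Finset.sum_sub_distrib, ite_mul, zero_mul, Finset.sum_ite_eq', hgF,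
        if_true]
      ring
    rwa [this]

/-- Dickson's condition gives finitely many elements of I whose leads divide every lead of I.
Because they are finitely many, their gaps can be replaced by a single ε < 1, and division by them
has remainder smaller by ε, so they generate I. -/
theorem isNoetherianRing (X : ApproxExpansion M L R)
    (dickson : ∀ S : Set M, ∃ B : Finset M, ↑B ⊆ S ∧ ∀ J ∈ S, ∃ b ∈ B, ∃ K, J = b + K) :
    IsNoetherianRing R := by
  classical
  rw [isNoetherianRing_iff_ideal_fg]
  intro I
  obtain ⟨B, hBS, hB⟩ := dickson {J | ∃ f ∈ I, f ≠ 0 ∧ X.IsLead f J}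
  have hex : ∀ b : B, ∃ f, f ∈ I ∧ f ≠ 0 ∧ X.IsLead f b := fun b => hBS b.2
  choose φ hφI hφ0 hφ using hex
  set F : Finset R := Finset.univ.image φ with hF
  have hFm : ∀ g ∈ F, ∃ b : B, φ b = g := fun g hg => by simpa [hF] using hg
  -- The value at g = 0 is arbitrary; leads are used only on F, which does not contain 0.
  have hld : ∀ g, ∃ J, g ≠ 0 → X.IsLead g J := fun g => by
    by_cases hg : g = 0
    · exact ⟨0, fun h => absurd hg h⟩
    · obtain ⟨J, hJ⟩ := X.exists_isLead hg
      exact ⟨J, fun _ => hJ⟩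
  choose ld hld using hld
  have hF0 : ∀ g ∈ F, g ≠ 0 := fun g hg => by
    obtain ⟨b, rfl⟩ := hFm g hg; exact hφ0 b
  have huniq : ∀ {g : R} {J J' : M}, X.IsLead g J → X.IsLead g J' → J = J' := by
    intro g J J' h h'
    rcases lt_trichotomy J J' with hlt | rfl | hlt
    · exact absurd h'.1 (h.2 _ hlt).ne
    · rfl
    · exact absurd h.1 (h'.2 _ hlt).ne
  have hgap : ∀ g, ∃ ε < 1, g ≠ 0 → ∀ J' > ld g, X.size g J' ≤ ε * X.N g := fun g => by
    by_cases hg : g = 0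
    · exact ⟨0, zero_lt_one, fun h => absurd hg h⟩
    · obtain ⟨ε, h1, h2⟩ := (hld g hg).exists_gap X hg
      exact ⟨ε, h1, fun _ => h2⟩
  choose e he1 he using hgap
  have hs : (insert X.θ (F.image e)).Nonempty := Finset.insert_nonempty _ _
  set ε := (insert X.θ (F.image e)).max' hs with hε
  have hεe : ∀ g ∈ F, e g ≤ ε := fun g hg =>
    Finset.le_max' _ _ (Finset.mem_insert_of_mem (Finset.mem_image_of_mem _ hg))
  have hθ : X.θ ≤ ε := Finset.le_max' _ _ (Finset.mem_insert_self _ _)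
  have hε1 : ε < 1 := by
    rw [hε, Finset.max'_lt_iff]
    intro y hy
    rcases Finset.mem_insert.1 hy with rfl | hy
    · exact X.θ_lt
    · obtain ⟨g, -, rfl⟩ := Finset.mem_image.1 hy
      exact he1 g
  have hκ0 : ∀ g, 0 ≤ X.N 1 / X.N g := fun g => div_nonneg (apply_nonneg _ _) (apply_nonneg _ _)
  have hκ : 0 ≤ ∑ g ∈ F, X.N 1 / X.N g := Finset.sum_nonneg fun g _ => hκ0 g
  have hFI : ∀ g ∈ F, g ∈ I := fun g hg => by
    obtain ⟨b, rfl⟩ := hFm g hg; exact hφI b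
  refine ⟨F, (X.eq_span_of_division (X.θ_nonneg.trans hθ) hε1 hκ hFI
    fun C hC f hf hfC => X.exists_division (ld := ld) hθ hFI hF0
      (fun g hg => (hld g (hF0 g hg)).1) (fun g hg J' hJ' => (he g (hF0 g hg) J' hJ').trans ?_)
      (fun g hg => Finset.single_le_sum (f := fun g => X.N 1 / X.N g) (fun g _ => hκ0 g) hg) hκ
      ?_ hC hf hfC).symm⟩
  · exact mul_le_mul_of_nonneg_right (hεe g hg) (apply_nonneg _ _)
  · intro f hf hf0 J hJ
    obtain ⟨b, hb, K, rfl⟩ := hB J ⟨f, hf, hf0, hJ⟩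
    refine ⟨φ ⟨b, hb⟩, Finset.mem_image_of_mem _ (Finset.mem_univ _), K, ?_⟩
    rw [huniq (hld _ (hφ0 ⟨b, hb⟩)) (hφ ⟨b, hb⟩)]

end Order

end ApproxExpansion

/-! ### Sizes of single terms -/

section TermSize
variable {p : ℕ} {r : ℝ} {L : Type*} [NontriviallyNormedField L]

/-- The weight `p ^ (-k) * ‖a‖ ^ r` of the term `ϖ ^ k [a]` in the Gauss norm. -/
noncomputable def termSize (r : ℝ) (p : ℕ) (k : ℕ) (a : L) : ℝ := (p : ℝ) ^ (-(k : ℤ)) * ‖a‖ ^ r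

theorem termSize_nonneg (k : ℕ) (a : L) : 0 ≤ termSize r p k a := by
  unfold termSize; positivity

theorem termSize_add_le [Fact p.Prime] [IsUltrametricDist L] (hr : 0 < r) (k : ℕ) {a b : L}
    {C : ℝ} (ha : termSize r p k a ≤ C)
    (hb : termSize r p k b ≤ C) : termSize r p k (a + b) ≤ C := by
  have hC : 0 ≤ C := (termSize_nonneg k a).trans ha
  rw [termSize, term_le_iff hr hC (norm_nonneg _)] at *
  exact (IsUltrametricDist.norm_add_le_max _ _).trans (max_le ha hb)

theorem termSize_mul [Fact p.Prime] (j k : ℕ) (a b : L) :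
    termSize r p (j + k) (a * b) = termSize r p k a * termSize r p j b := by
  have hp : (p : ℝ) ≠ 0 := by exact_mod_cast (Fact.out : p.Prime).ne_zero
  rw [termSize, termSize, termSize, norm_mul, Real.mul_rpow (norm_nonneg _) (norm_nonneg _),
    Nat.cast_add, neg_add, zpow_add₀ hp]
  ring

end TermSize

/-! ### Teichmüller digits: carries, norms and monomials -/

section Digits
variable {p : ℕ} [Fact p.Prime] {O : Type*} [CommRing O] [IsDomain O]
  [IsDiscreteValuationRing O] [IsAdicComplete (maximalIdeal O) O] [CharP (ResidueField O) p]
  [Finite (ResidueField O)] {L : Type*} [NontriviallyNormedField L] [IsUltrametricDist L]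
  [CharP L p] [PerfectRing L p] [Algebra (ResidueField O) L] {ϖ : O} (hϖ : Irreducible ϖ)

theorem digit_zero_eq_red (x : RamWitt p O L) : digit hϖ x 0 = red p O L x :=
  ((isTeichExpansion_digit hϖ x).head hϖ).symm

/-- The zeroth digit is reduction modulo ϖ, a ring homomorphism; there is no carry into it. -/
theorem digit_add_zero (x y : RamWitt p O L) :
    digit hϖ (x + y) 0 = digit hϖ x 0 + digit hϖ y 0 := by
  simp only [digit_zero_eq_red, map_add]

/-- The carries in the addition of two Teichmüller expansions are shifted by one place. -/
theorem norm_digit_add_sub_le (n : ℕ) : ∀ {c : ℕ → ℝ} (_ : Monotone c) {x y : RamWitt p O L}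
    (_ : ∀ m, ‖digit hϖ x m‖ ≤ c m) (_ : ∀ m, ‖digit hϖ y m‖ ≤ c m),
    ‖digit hϖ (x + y) (n + 1) - (digit hϖ x (n + 1) + digit hϖ y (n + 1))‖ ≤ c n := by
  induction n with
  | zero =>
    intro c hc x y hx hy
    obtain ⟨x', hx', hxd⟩ := exists_tail hϖ x
    obtain ⟨y', hy', hyd⟩ := exists_tail hϖ y
    obtain ⟨s', hs', hsd⟩ := exists_tail hϖ
      (teich p (digit hϖ x 0) + teich p (digit hϖ y 0) : RamWitt p O L)
    have hsum : x + y = teich p (digit hϖ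
        (teich p (digit hϖ x 0) + teich p (digit hϖ y 0) : RamWitt p O L) 0) +
        scal p L ϖ * (s' + (x' + y')) := by
      conv_lhs => rw [hx', hy']
      linear_combination hs'
    -- Zeroth digits being additive, what remains is the first digit of the sum of the two leading
    -- Teichmüller terms, that is, the carry.
    rw [digit_succ_of_eq hϖ hsum, hxd, hyd, digit_add_zero, digit_add_zero, add_sub_cancel_right,
      ← hsd]
    exact norm_digit_teich_add_teich_le hϖ (hx 0) (hy 0) 1
  | succ n ih =>
    intro c hc x y hx hy
    obtain ⟨x', hx', hxd⟩ := exists_tail hϖ x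
    obtain ⟨y', hy', hyd⟩ := exists_tail hϖ y
    obtain ⟨s', hs', hsd⟩ := exists_tail hϖ
      (teich p (digit hϖ x 0) + teich p (digit hϖ y 0) : RamWitt p O L)
    have hsum : x + y = teich p (digit hϖ
        (teich p (digit hϖ x 0) + teich p (digit hϖ y 0) : RamWitt p O L) 0) +
        scal p L ϖ * (s' + (x' + y')) := by
      conv_lhs => rw [hx', hy']
      linear_combination hs'
    have hc' : Monotone fun m => c (m + 1) := fun a b hab => hc (by omega)
    have hs'c : ∀ m, ‖digit hϖ s' m‖ ≤ c 0 := fun m => by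
      rw [← hsd]; exact norm_digit_teich_add_teich_le hϖ (hx 0) (hy 0) _
    have hx'c : ∀ m, ‖digit hϖ x' m‖ ≤ c (m + 1) := fun m => by rw [← hxd]; exact hx _
    have hy'c : ∀ m, ‖digit hϖ y' m‖ ≤ c (m + 1) := fun m => by rw [← hyd]; exact hy _
    have h1 := ih hc' hx'c hy'c
    have h2 := ih hc' (fun m => (hs'c m).trans (hc (Nat.zero_le _)))
      (fun m => norm_digit_add_le hϖ m hc' (fun j _ => hx'c j) (fun j _ => hy'c j))
    have h3 : ‖digit hϖ s' (n + 1)‖ ≤ c (n + 1) := (hs'c _).trans (hc (Nat.zero_le _))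
    rw [digit_succ_of_eq hϖ hsum, hxd, hyd]
    -- The error splits into the error of adding the carry s' to x' + y', the error of adding x' and
    -- y', and a digit of s'. The first two fall under the induction hypothesis for the shifted
    -- bound.
    have : digit hϖ (s' + (x' + y')) (n + 1) - (digit hϖ x' (n + 1) + digit hϖ y' (n + 1)) =
        (digit hϖ (s' + (x' + y')) (n + 1) -
          (digit hϖ s' (n + 1) + digit hϖ (x' + y') (n + 1))) +
        ((digit hϖ (x' + y') (n + 1) - (digit hϖ x' (n + 1) + digit hϖ y' (n + 1))) +
          digit hϖ s' (n + 1)) := by ring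
    rw [this]
    exact (IsUltrametricDist.norm_add_le_max _ _).trans
      (max_le h2 ((IsUltrametricDist.norm_add_le_max _ _).trans (max_le h1 h3)))

variable {r : ℝ} {hr : 0 < r}

/-- The `k`-th coefficient of the Teichmüller expansion of an element of `A_{L,E}`. -/
noncomputable def gaussDigit (x : GaussAInt p L hϖ hr) (k : ℕ) : L :=
  digit hϖ (show AInt p O L from x : RamWitt p O L) k

variable {hϖ}

theorem norm_eq_iSup (x : GaussAInt p L hϖ hr) :
    ‖x‖ = ⨆ k, termSize r p k (gaussDigit hϖ x k) := rfl

theorem termSize_le_norm (x : GaussAInt p L hϖ hr) (k : ℕ) :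
    termSize r p k (gaussDigit hϖ x k) ≤ ‖x‖ :=
  le_ciSup (bddAbove_gauss hϖ hr (show AInt p O L from x).2) k

/-- The digits of an element of A_{L,E} are bounded, and the factor p ^ (-k) tends to 0. -/
theorem tendsto_termSize (x : GaussAInt p L hϖ hr) :
    Filter.Tendsto (fun k => termSize r p k (gaussDigit hϖ x k)) Filter.atTop (nhds 0) := by
  obtain ⟨C, hC⟩ := exists_norm_digit_le hϖ (show AInt p O L from x).2
  have hp : (1 : ℝ) < p := by exact_mod_cast (Fact.out : p.Prime).one_lt
  have hlim : Filter.Tendsto (fun k : ℕ => ((p : ℝ)⁻¹) ^ k * C ^ r) Filter.atTop (nhds 0) := by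
    simpa using (tendsto_pow_atTop_nhds_zero_of_lt_one (by positivity)
      (inv_lt_one_of_one_lt₀ hp)).mul_const (C ^ r)
  refine squeeze_zero (fun k => termSize_nonneg k _) (fun k => ?_) hlim
  rw [termSize, zpow_neg, zpow_natCast, inv_pow]
  gcongr
  exact hC k

theorem finite_lt_termSize (x : GaussAInt p L hϖ hr) {δ : ℝ} (hδ : 0 < δ) :
    {k | δ < termSize r p k (gaussDigit hϖ x k)}.Finite := by
  have h := (tendsto_termSize x).eventually_le_const hδ
  rw [← Nat.cofinite_eq_atTop, Filter.eventually_cofinite] at h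
  simpa using h

theorem exists_termSize_eq_norm (x : GaussAInt p L hϖ hr) (hx : 0 < ‖x‖) :
    ∃ k, termSize r p k (gaussDigit hϖ x k) = ‖x‖ := by
  have hne : ∃ k, ‖x‖ / 2 < termSize r p k (gaussDigit hϖ x k) :=
    exists_lt_of_lt_ciSup (by rw [← norm_eq_iSup]; linarith)
  obtain ⟨k, hk, hmax⟩ := Set.exists_max_image _ (fun k => termSize r p k (gaussDigit hϖ x k))
    (finite_lt_termSize x (half_pos hx)) hne
  refine ⟨k, le_antisymm (termSize_le_norm x k) ?_⟩
  rw [norm_eq_iSup x]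
  refine ciSup_le fun j => ?_
  by_cases hj : ‖x‖ / 2 < termSize r p j (gaussDigit hϖ x j)
  · exact hmax j hj
  · exact (not_lt.1 hj).trans (le_of_lt hk)

/-- A carry into place k + 1 satisfies the bound for place k, and the Gauss norm gives place k + 1
an extra factor p⁻¹. Place 0 receives no carry. -/
theorem termSize_gaussDigit_add_sub_le (x y : GaussAInt p L hϖ hr) (k : ℕ) :
    termSize r p k (gaussDigit hϖ (x + y) k - (gaussDigit hϖ x k + gaussDigit hϖ y k)) ≤
      (p : ℝ)⁻¹ * max ‖x‖ ‖y‖ := by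
  have hp : (0 : ℝ) < p := by exact_mod_cast (Fact.out : p.Prime).pos
  have hD : 0 ≤ max ‖x‖ ‖y‖ := le_max_of_le_left (norm_nonneg _)
  cases k with
  | zero =>
    have : gaussDigit hϖ (x + y) 0 = gaussDigit hϖ x 0 + gaussDigit hϖ y 0 :=
      digit_add_zero hϖ _ _
    rw [this, sub_self, termSize, norm_zero, Real.zero_rpow hr.ne', mul_zero]
    positivity
  | succ k =>
    rw [termSize, term_le_iff hr (by positivity) (norm_nonneg _)]
    have : gaugeBound p r ((p : ℝ)⁻¹ * max ‖x‖ ‖y‖) (k + 1) = gaugeBound p r (max ‖x‖ ‖y‖) k := by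
      unfold gaugeBound
      congr 1
      field_simp
      ring
    rw [this]
    refine norm_digit_add_sub_le hϖ k (gaugeBound_mono hr hD) (fun m => ?_) (fun m => ?_)
    · exact (term_le_iff hr hD (norm_nonneg _) m).1 ((termSize_le_norm x m).trans (le_max_left _ _))
    · exact (term_le_iff hr hD (norm_nonneg _) m).1
        ((termSize_le_norm y m).trans (le_max_right _ _))

/-- Write x = y + (x - y): the digits differ by those of x - y and by carries. Thus nearby elements
have nearby digits up to a relative error p⁻¹, which makes digits of approximations meaningful. -/
theorem termSize_gaussDigit_sub_le (x y : GaussAInt p L hϖ hr) (k : ℕ) :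
    termSize r p k (gaussDigit hϖ x k - gaussDigit hϖ y k) ≤ max ‖x - y‖ ((p : ℝ)⁻¹ * ‖y‖) := by
  have hp : (1 : ℝ) < p := by exact_mod_cast (Fact.out : p.Prime).one_lt
  have hp1 : (p : ℝ)⁻¹ ≤ 1 := (inv_lt_one_of_one_lt₀ hp).le
  have h1 := termSize_gaussDigit_add_sub_le y (x - y) k
  rw [add_sub_cancel] at h1
  have h2 : gaussDigit hϖ x k - gaussDigit hϖ y k =
      (gaussDigit hϖ x k - (gaussDigit hϖ y k + gaussDigit hϖ (x - y) k)) +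
        gaussDigit hϖ (x - y) k := by ring
  rw [h2]
  refine termSize_add_le hr k (h1.trans ?_)
    ((termSize_le_norm _ k).trans (le_max_left _ _))
  rw [mul_max_of_nonneg _ _ (by positivity)]
  refine max_le (le_max_right _ _) (le_max_of_le_left ?_)
  exact mul_le_of_le_one_left (norm_nonneg _) hp1

variable (hϖ hr) in
/-- The element `[a] ϖ ^ k` of `A_{L,E}`. -/
noncomputable def gaussMonomial (a : L) (k : ℕ) : GaussAInt p L hϖ hr :=
  show AInt p O L from ⟨teich p a * scal p L (ϖ ^ k), Subring.mul_mem _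
    (Subring.subset_closure (Or.inr ⟨a, rfl⟩))
    (Subring.subset_closure (Or.inl ⟨scal p _ (ϖ ^ k), inclWitt_scal p O L _⟩))⟩

theorem digit_scal_pow_mul_add (x : RamWitt p O L) (k j : ℕ) :
    digit hϖ (scal p L (ϖ ^ k) * x) (j + k) = digit hϖ x j := by
  induction k with
  | zero => simp
  | succ k ih =>
    rw [pow_succ', map_mul, mul_assoc, ← add_assoc, digit_uniformizer_mul_succ, ih]

theorem digit_scal_pow_mul_of_lt (x : RamWitt p O L) {k j : ℕ} (h : j < k) :
    digit hϖ (scal p L (ϖ ^ k) * x) j = 0 := by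
  induction k generalizing j with
  | zero => omega
  | succ k ih =>
    rw [pow_succ', map_mul, mul_assoc]
    cases j with
    | zero => exact digit_uniformizer_mul_zero hϖ _
    | succ j => rw [digit_uniformizer_mul_succ, ih (by omega)]

/-- Teichmüller lifts are multiplicative, so a monomial shifts and scales the expansion exactly,
without carries. -/
theorem gaussDigit_monomial_mul_add (a : L) (k : ℕ) (x : GaussAInt p L hϖ hr) (j : ℕ) :
    gaussDigit hϖ (gaussMonomial hϖ hr a k * x) (j + k) = a * gaussDigit hϖ x j := by
  change digit hϖ (teich p a * scal p L (ϖ ^ k) * (show AInt p O L from x : RamWitt p O L)) _ = _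
  rw [mul_assoc, digit_teich_mul, digit_scal_pow_mul_add]; rfl

theorem gaussDigit_monomial_mul_of_lt (a : L) {k : ℕ} (x : GaussAInt p L hϖ hr) {j : ℕ}
    (h : j < k) : gaussDigit hϖ (gaussMonomial hϖ hr a k * x) j = 0 := by
  change digit hϖ (teich p a * scal p L (ϖ ^ k) * (show AInt p O L from x : RamWitt p O L)) _ = _
  rw [mul_assoc, digit_teich_mul, digit_scal_pow_mul_of_lt _ h, mul_zero]

theorem norm_gaussMonomial_mul_le (a : L) (k : ℕ) (x : GaussAInt p L hϖ hr) :
    ‖gaussMonomial hϖ hr a k * x‖ ≤ termSize r p k a * ‖x‖ := by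
  rw [norm_eq_iSup (gaussMonomial hϖ hr a k * x)]
  refine ciSup_le fun j => ?_
  rcases lt_or_ge j k with h | h
  · rw [gaussDigit_monomial_mul_of_lt a x h, termSize, norm_zero, Real.zero_rpow hr.ne', mul_zero]
    exact mul_nonneg (termSize_nonneg _ _) (norm_nonneg _)
  · obtain ⟨j, rfl⟩ := Nat.exists_eq_add_of_le' h
    rw [gaussDigit_monomial_mul_add, termSize_mul]
    exact mul_le_mul_of_nonneg_left (termSize_le_norm x j) (termSize_nonneg _ _)

end Digits

/-! ### The Gauss norm on weighted Tate algebras and its completeness -/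

section Tate
variable {A : Type*} [NormedCommRing A] [IsUltrametricDist A] {n : ℕ} {ρ : Fin n → ℝ}

/-- The weight `ρ_1 ^ i_1 ⋯ ρ_n ^ i_n` of the monomial `T ^ I`. -/
noncomputable def monomialWeight (ρ : Fin n → ℝ) (I : Fin n →₀ ℕ) : ℝ := I.prod (ρ · ^ ·)

theorem monomialWeight_pos (hρ : ∀ i, 0 < ρ i) (I : Fin n →₀ ℕ) : 0 < monomialWeight ρ I :=
  Finset.prod_pos fun i _ => pow_pos (hρ i) _

theorem monomialWeight_add (I J : Fin n →₀ ℕ) :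
    monomialWeight ρ (I + J) = monomialWeight ρ I * monomialWeight ρ J :=
  Finsupp.prod_add_index' (h := (ρ · ^ ·)) (by simp) (by simp [pow_add])

theorem tendsto_norm_coeff (f : weightedTate A ρ) :
    Tendsto (fun I => ‖MvPowerSeries.coeff I f.1‖ * monomialWeight ρ I) cofinite (𝓝 0) := f.2

theorem hasGaussNorm (f : weightedTate A ρ) :
    MvPowerSeries.HasGaussNorm (fun a : A => ‖a‖) ρ f.1 :=
  (tendsto_norm_coeff f).bddAbove_range_of_cofinite

variable (A) in
/-- The Gauss norm on the weighted Tate algebra. -/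
noncomputable def tateNorm (hρ : ∀ i, 0 < ρ i) : RingNorm (weightedTate A ρ) where
  toFun f := MvPowerSeries.gaussNorm (fun a : A => ‖a‖) ρ f.1
  map_zero' := MvPowerSeries.gaussNorm_zero _ _ norm_zero
  add_le' f g := (MvPowerSeries.gaussNorm_add_le_max _ _ _ _ (fun i => (hρ i).le)
    (fun a => norm_nonneg a) IsUltrametricDist.isNonarchimedean_norm
    (hasGaussNorm f) (hasGaussNorm g)).trans
    (max_le_add_of_nonneg (MvPowerSeries.gaussNorm_nonneg _ _ _ fun a => norm_nonneg a)
      (MvPowerSeries.gaussNorm_nonneg _ _ _ fun a => norm_nonneg a))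
  neg' _ := MvPowerSeries.gaussNorm_neg _ _ (fun a => norm_neg a) _
  mul_le' f g := MvPowerSeries.gaussNorm_mul_le _ _ _ _ (fun i => (hρ i).le)
    (fun a => norm_nonneg a) norm_mul_le IsUltrametricDist.isNonarchimedean_norm norm_zero
    (hasGaussNorm f) (hasGaussNorm g)
  eq_zero_of_map_eq_zero' f hf := Subtype.ext ((MvPowerSeries.gaussNorm_eq_zero_iff _ _ _ norm_zero
    (fun a => norm_nonneg a) (fun _ h => norm_eq_zero.1 h) hρ (hasGaussNorm f)).1 hf)

variable (hρ : ∀ i, 0 < ρ i)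

theorem isNonarchimedean_tateNorm : IsNonarchimedean (tateNorm A hρ) := fun f g =>
  MvPowerSeries.gaussNorm_add_le_max _ _ _ _ (fun i => (hρ i).le)
    (fun a => norm_nonneg a) IsUltrametricDist.isNonarchimedean_norm
    (hasGaussNorm f) (hasGaussNorm g)

theorem norm_coeff_mul_le_tateNorm (f : weightedTate A ρ) (I : Fin n →₀ ℕ) :
    ‖MvPowerSeries.coeff I f.1‖ * monomialWeight ρ I ≤ tateNorm A hρ f :=
  MvPowerSeries.le_gaussNorm _ _ _ (hasGaussNorm f) I

theorem tateNorm_le {f : weightedTate A ρ} {C : ℝ}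
    (h : ∀ I, ‖MvPowerSeries.coeff I f.1‖ * monomialWeight ρ I ≤ C) : tateNorm A hρ f ≤ C :=
  ciSup_le h

theorem finite_lt_norm_coeff (f : weightedTate A ρ) {δ : ℝ} (hδ : 0 < δ) :
    {I | δ < ‖MvPowerSeries.coeff I f.1‖ * monomialWeight ρ I}.Finite := by
  have h := (tendsto_norm_coeff f).eventually_le_const hδ
  rw [eventually_cofinite] at h
  simpa using h

theorem exists_norm_coeff_eq_tateNorm {f : weightedTate A ρ} (hf : 0 < tateNorm A hρ f) :
    ∃ I, ‖MvPowerSeries.coeff I f.1‖ * monomialWeight ρ I = tateNorm A hρ f := by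
  have hne : ∃ I, tateNorm A hρ f / 2 < ‖MvPowerSeries.coeff I f.1‖ * monomialWeight ρ I := by
    by_contra! h
    linarith [tateNorm_le hρ h]
  obtain ⟨I, hI, hmax⟩ := Set.exists_max_image _
    (fun I => ‖MvPowerSeries.coeff I f.1‖ * monomialWeight ρ I)
    (finite_lt_norm_coeff f (half_pos hf)) hne
  refine ⟨I, le_antisymm (norm_coeff_mul_le_tateNorm hρ f I) (tateNorm_le hρ fun J => ?_)⟩
  by_cases hJ : tateNorm A hρ f / 2 < ‖MvPowerSeries.coeff J f.1‖ * monomialWeight ρ J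
  · exact hmax J hJ
  · exact (not_lt.1 hJ).trans (le_of_lt hI)

theorem coeff_sum_weightedTate (a : ℕ → weightedTate A ρ) (s : Finset ℕ) (I : Fin n →₀ ℕ) :
    MvPowerSeries.coeff I (∑ i ∈ s, a i).1 = ∑ i ∈ s, MvPowerSeries.coeff I (a i).1 := by
  rw [AddSubmonoidClass.coe_finsetSum, map_sum]

/-- The sum is formed coefficientwise, where it converges because A is complete and ultrametric. The
tail bounds are uniform in the index after weighting, so the limit is uniformly close to a finite
partial sum, and hence is again restricted. -/
theorem exists_tateNorm_sub_sum_le [CompleteSpace A] (a : ℕ → weightedTate A ρ) (b : ℕ → ℝ)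
    (hb : Antitone b) (hb0 : Tendsto b atTop (𝓝 0)) (hab : ∀ s, tateNorm A hρ (a s) ≤ b s) :
    ∃ x, ∀ S, tateNorm A hρ (x - ∑ s ∈ Finset.range S, a s) ≤ b S := by
  have hw := monomialWeight_pos hρ
  have hcoeff : ∀ s I, ‖MvPowerSeries.coeff I (a s).1‖ ≤ b s / monomialWeight ρ I := fun s I => by
    rw [le_div_iff₀ (hw I)]
    exact (norm_coeff_mul_le_tateNorm hρ (a s) I).trans (hab s)
  have hsummable : ∀ I, Summable fun s => MvPowerSeries.coeff I (a s).1 := fun I => by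
    refine NonarchimedeanAddGroup.summable_of_tendsto_cofinite_zero ?_
    rw [Nat.cofinite_eq_atTop]
    refine squeeze_zero_norm (fun s => hcoeff s I) ?_
    simpa using hb0.div_const (monomialWeight ρ I)
  let x : MvPowerSeries (Fin n) A := fun I => ∑' s, MvPowerSeries.coeff I (a s).1
  have hx : ∀ S I, ‖MvPowerSeries.coeff I x - ∑ s ∈ Finset.range S, MvPowerSeries.coeff I (a s).1‖ ≤
      b S / monomialWeight ρ I := by
    intro S I
    have h1 : Tendsto (fun m => ∑ s ∈ Finset.range m, MvPowerSeries.coeff I (a s).1 -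
        ∑ s ∈ Finset.range S, MvPowerSeries.coeff I (a s).1) atTop
        (𝓝 (MvPowerSeries.coeff I x - ∑ s ∈ Finset.range S, MvPowerSeries.coeff I (a s).1)) :=
      (hsummable I).hasSum.tendsto_sum_nat.sub_const _
    refine le_of_tendsto h1.norm (eventually_atTop.2 ⟨S, fun m hm => ?_⟩)
    rw [← Finset.sum_Ico_eq_sub _ hm]
    have hbS : 0 ≤ b S / monomialWeight ρ I := (norm_nonneg _).trans (hcoeff S I)
    refine IsUltrametricDist.norm_sum_le_of_forall_le_of_nonneg hbS fun s hs => ?_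
    refine (hcoeff s I).trans (div_le_div_of_nonneg_right (hb (Finset.mem_Ico.1 hs).1) (hw I).le)
  have hxr : MvPowerSeries.IsRestricted ρ x := by
    change Tendsto (fun I => ‖MvPowerSeries.coeff I x‖ * monomialWeight ρ I) cofinite (𝓝 0)
    rw [NormedAddGroup.tendsto_nhds_zero]
    intro ε hε
    obtain ⟨S, hS⟩ := (hb0.eventually_lt_const hε).exists
    have hsum := (tendsto_norm_coeff (∑ s ∈ Finset.range S, a s)).eventually_lt_const hε
    filter_upwards [hsum] with I hI
    rw [coeff_sum_weightedTate] at hI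
    rw [Real.norm_of_nonneg (mul_nonneg (norm_nonneg _) (hw I).le)]
    have h1 := IsUltrametricDist.norm_add_le_max
      (MvPowerSeries.coeff I x - ∑ s ∈ Finset.range S, MvPowerSeries.coeff I (a s).1)
      (∑ s ∈ Finset.range S, MvPowerSeries.coeff I (a s).1)
    rw [sub_add_cancel] at h1
    have h2 := hx S I
    rw [le_div_iff₀ (hw I)] at h2
    refine (mul_le_mul_of_nonneg_right h1 (hw I).le).trans_lt ?_
    rw [max_mul_of_nonneg _ _ (hw I).le]
    exact max_lt (h2.trans_lt hS) hI
  refine ⟨⟨x, hxr⟩, fun S => tateNorm_le hρ fun I => ?_⟩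
  rw [← le_div_iff₀ (hw I)]
  refine le_trans (le_of_eq ?_) (hx S I)
  rw [AddSubgroupClass.coe_sub, map_sub, coeff_sum_weightedTate]

end Tate

/-- Dickson's lemma. The lexicographic order plays no role here: for the componentwise order the
minimal elements of S form an antichain, finite by well-quasi-ordering, and being componentwise
larger than b means being b + K. -/
theorem exists_finset_forall_exists_add {σ : Type*} [Finite σ] [LinearOrder σ]
    (S : Set (Lex (σ →₀ ℕ) ×ₗ ℕ)) :
    ∃ B : Finset (Lex (σ →₀ ℕ) ×ₗ ℕ), ↑B ⊆ S ∧ ∀ J ∈ S, ∃ b ∈ B, ∃ K, J = b + K := by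
  classical
  let φ : (σ →₀ ℕ) × ℕ → Lex (σ →₀ ℕ) ×ₗ ℕ := fun x => toLex (toLex x.1, x.2)
  obtain ⟨B, hB, hBS⟩ : ∃ B : Set ((σ →₀ ℕ) × ℕ), B.Finite ∧ B ⊆ φ ⁻¹' S ∧
      ∀ x ∈ φ ⁻¹' S, ∃ b ∈ B, b ≤ x :=
    ⟨{m | Minimal (· ∈ φ ⁻¹' S) m},
      WellQuasiOrderedLE.finite_of_isAntichain (setOfPred_minimal_antichain _),
      fun _ hm => hm.prop, fun x hx => by
        obtain ⟨m, hm, hmin⟩ := exists_minimal_le_of_wellFoundedLT (· ∈ φ ⁻¹' S) x hx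
        exact ⟨m, hmin, hm⟩⟩
  refine ⟨hB.toFinset.image φ, ?_, fun J hJ => ?_⟩
  · intro b hb
    obtain ⟨x, hx, rfl⟩ := Finset.mem_image.1 hb
    exact hBS.1 (hB.mem_toFinset.1 hx)
  · obtain ⟨x, rfl⟩ : ∃ x, φ x = J := ⟨(ofLex (ofLex J).1, (ofLex J).2), rfl⟩
    obtain ⟨m, hm, hmx⟩ := hBS.2 x hJ
    obtain ⟨K, rfl⟩ := exists_add_of_le hmx
    exact ⟨φ m, Finset.mem_image_of_mem _ (hB.mem_toFinset.2 hm), φ K, rfl⟩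

theorem norm_sub_le_max {A : Type*} [SeminormedAddCommGroup A] [IsUltrametricDist A] (x y : A) :
    ‖x - y‖ ≤ max ‖x‖ ‖y‖ := by
  simpa [sub_eq_add_neg] using IsUltrametricDist.norm_add_le_max x (-y)

/-- The absolute value `‖·‖ ^ r` of a nonarchimedean normed field. -/
noncomputable def rpowAbs (L : Type*) [NontriviallyNormedField L] [IsUltrametricDist L] {r : ℝ}
    (hr : 0 < r) : AbsoluteValue L ℝ where
  toFun a := ‖a‖ ^ r
  map_mul' a b := by rw [norm_mul, Real.mul_rpow (norm_nonneg _) (norm_nonneg _)]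
  nonneg' a := by positivity
  eq_zero' a := by rw [Real.rpow_eq_zero (norm_nonneg _) hr.ne', norm_eq_zero]
  add_le' a b := by
    have h := Real.rpow_le_rpow (norm_nonneg _) (IsUltrametricDist.norm_add_le_max a b) hr.le
    refine h.trans ?_
    rcases max_choice ‖a‖ ‖b‖ with h | h <;> rw [h]
    · exact le_add_of_nonneg_right (by positivity)
    · exact le_add_of_nonneg_left (by positivity)

theorem isNonarchimedean_rpowAbs (L : Type*) [NontriviallyNormedField L] [IsUltrametricDist L]
    {r : ℝ} (hr : 0 < r) : IsNonarchimedean (rpowAbs L hr) := fun a b => by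
  have h := Real.rpow_le_rpow (norm_nonneg _) (IsUltrametricDist.norm_add_le_max a b) hr.le
  rcases max_choice ‖a‖ ‖b‖ with h' | h' <;> rw [h'] at h
  · exact le_max_of_le_left h
  · exact le_max_of_le_right h

/-- Expansions of the elements of a seminormed ring in powers of a uniformizer, with coefficients
in a normed field `L`, such that the norm is the maximum of the sizes `p ^ (-k) * ‖a‖ ^ r` of the
terms. -/
structure DigitExpansion (p : ℕ) (r : ℝ) (L B : Type*) [NontriviallyNormedField L]
    [SeminormedCommRing B] where
  /-- the coefficients of the expansions -/
  d : B → ℕ → L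
  le_norm : ∀ x k, termSize r p k (d x k) ≤ ‖x‖
  finite : ∀ (x : B) {δ : ℝ}, 0 < δ → {k | δ < termSize r p k (d x k)}.Finite
  exists_eq_norm : ∀ x, 0 < ‖x‖ → ∃ k, termSize r p k (d x k) = ‖x‖
  add : ∀ x y k, termSize r p k (d (x + y) k - (d x k + d y k)) ≤ (p : ℝ)⁻¹ * max ‖x‖ ‖y‖
  sub : ∀ x y k, termSize r p k (d x k - d y k) ≤ max ‖x - y‖ ((p : ℝ)⁻¹ * ‖y‖)
  /-- the monomials -/
  mono : L → ℕ → B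
  norm_mono_mul_le : ∀ a k x, ‖mono a k * x‖ ≤ termSize r p k a * ‖x‖
  d_mono_mul_add : ∀ a k x j, d (mono a k * x) (j + k) = a * d x j
  d_mono_mul_of_lt : ∀ a k x j, j < k → d (mono a k * x) j = 0

/-! ### From digits in B to expansions in the Tate algebra over its completion -/

namespace DigitExpansion

open UniformSpace

variable {B : Type*} [SeminormedCommRing B]

/-- Elements of norm at most δ are approximated by 0 on purpose: this makes all but finitely many
approximate coefficients of a restricted series vanish, and lets δ = 0 serve for the zero series. -/
theorem exists_approx (x : Completion B) (δ : ℝ) :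
    ∃ y : B, (0 < δ → ‖x - y‖ ≤ δ) ∧ (‖x‖ ≤ δ → y = 0) := by
  by_cases h : ‖x‖ ≤ δ
  · exact ⟨0, fun _ => by rwa [Completion.coe_zero, sub_zero], fun _ => rfl⟩
  by_cases hδ : 0 < δ
  · obtain ⟨y, hy⟩ := Completion.denseRange_coe.exists_dist_lt x hδ
    rw [dist_eq_norm] at hy
    exact ⟨y, fun _ => hy.le, fun h' => absurd h' h⟩
  · exact ⟨0, fun h' => absurd h' hδ, fun _ => rfl⟩

/-- An approximation of an element of the completion of `B` by an element of `B`, up to `δ`. -/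
noncomputable def approx (x : Completion B) (δ : ℝ) : B :=
  (exists_approx x δ).choose

theorem norm_sub_approx_le (x : Completion B) {δ : ℝ} (hδ : 0 < δ) :
    ‖x - approx x δ‖ ≤ δ := (exists_approx x δ).choose_spec.1 hδ

theorem approx_eq_zero {x : Completion B} {δ : ℝ} (hδ : ‖x‖ ≤ δ) : approx x δ = 0 :=
  (exists_approx x δ).choose_spec.2 hδ

variable [IsUltrametricDist (Completion B)] {n : ℕ} {ρ : Fin n → ℝ}
  {p : ℕ} [Fact p.Prime]

section Coeff
variable (hρ : ∀ i, 0 < ρ i)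

variable (p) in
/-- The coefficients of a power series, approximated by elements of `B` with a relative
precision of `p⁻¹`. -/
noncomputable def approxCoeff (f : weightedTate (Completion B) ρ) (I : Fin n →₀ ℕ) :
    B :=
  approx (MvPowerSeries.coeff I f.1) ((p : ℝ)⁻¹ * tateNorm _ hρ f / monomialWeight ρ I)

theorem norm_coeff_sub_approxCoeff_le (f : weightedTate (Completion B) ρ)
    (I : Fin n →₀ ℕ) : ‖MvPowerSeries.coeff I f.1 - approxCoeff p hρ f I‖ ≤
      (p : ℝ)⁻¹ * tateNorm _ hρ f / monomialWeight ρ I := by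
  have hp : (0 : ℝ) < p := by exact_mod_cast (Fact.out : p.Prime).pos
  have hw := monomialWeight_pos hρ I
  rcases (apply_nonneg (tateNorm (Completion B) hρ) f).eq_or_lt with h | h
  -- Here the precision is 0, but all coefficients vanish and 0 is approximated by 0.
  · have h0 : MvPowerSeries.coeff I f.1 = 0 := by
      have := norm_coeff_mul_le_tateNorm hρ f I
      rw [← h] at this
      exact norm_le_zero_iff.1 (nonpos_of_mul_nonpos_left this hw)
    rw [approxCoeff, approx_eq_zero (by rw [h0, norm_zero, ← h]; simp), h0, ← h]
    simp
  · exact norm_sub_approx_le _ (by positivity)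

theorem approxCoeff_eq_zero {f : weightedTate (Completion B) ρ} {I : Fin n →₀ ℕ}
    (h : ‖MvPowerSeries.coeff I f.1‖ * monomialWeight ρ I ≤ (p : ℝ)⁻¹ * tateNorm _ hρ f) :
    approxCoeff p hρ f I = 0 :=
  approx_eq_zero ((le_div_iff₀ (monomialWeight_pos hρ I)).2 h)

theorem inv_prime_lt_one : (p : ℝ)⁻¹ < 1 :=
  inv_lt_one_of_one_lt₀ (by exact_mod_cast (Fact.out : p.Prime).one_lt)

theorem norm_approxCoeff_le (f : weightedTate (Completion B) ρ) (I : Fin n →₀ ℕ) :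
    ‖approxCoeff p hρ f I‖ ≤ tateNorm _ hρ f / monomialWeight ρ I := by
  have hw := monomialWeight_pos hρ I
  have h1 := norm_sub_le_max (MvPowerSeries.coeff I f.1)
    (MvPowerSeries.coeff I f.1 - approxCoeff p hρ f I)
  rw [sub_sub_cancel, Completion.norm_coe] at h1
  refine h1.trans (max_le ?_ ((norm_coeff_sub_approxCoeff_le hρ f I).trans ?_))
  · rw [le_div_iff₀ hw]; exact norm_coeff_mul_le_tateNorm hρ f I
  · exact div_le_div_of_nonneg_right
      (mul_le_of_le_one_left (apply_nonneg _ _) inv_prime_lt_one.le) hw.le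

/-- At a coefficient attaining the Gauss norm the approximation error is strictly smaller than the
coefficient, so the ultrametric inequality preserves its norm. -/
theorem exists_norm_approxCoeff_eq {f : weightedTate (Completion B) ρ}
    (hf : 0 < tateNorm _ hρ f) :
    ∃ I, ‖approxCoeff p hρ f I‖ = tateNorm _ hρ f / monomialWeight ρ I := by
  obtain ⟨I, hI⟩ := exists_norm_coeff_eq_tateNorm hρ hf
  have hw := monomialWeight_pos hρ I
  refine ⟨I, le_antisymm (norm_approxCoeff_le hρ f I) ?_⟩
  rw [← eq_div_iff hw.ne'] at hI
  have h1 := IsUltrametricDist.norm_add_le_max (MvPowerSeries.coeff I f.1 - approxCoeff p hρ f I)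
    ((approxCoeff p hρ f I : B) : Completion B)
  rw [sub_add_cancel, Completion.norm_coe, hI] at h1
  refine (le_max_iff.1 h1).resolve_left (not_le.2 ?_)
  refine (norm_coeff_sub_approxCoeff_le hρ f I).trans_lt (div_lt_div_of_pos_right ?_ hw)
  exact mul_lt_of_lt_one_left hf inv_prime_lt_one

theorem finite_approxCoeff_ne_zero (f : weightedTate (Completion B) ρ) :
    {I | approxCoeff p hρ f I ≠ 0}.Finite := by
  have hp : (0 : ℝ) < p := by exact_mod_cast (Fact.out : p.Prime).pos
  rcases (apply_nonneg (tateNorm (Completion B) hρ) f).eq_or_lt with h | h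
  · refine Set.finite_empty.subset fun I hI => hI (approxCoeff_eq_zero hρ ?_)
    refine (norm_coeff_mul_le_tateNorm hρ f I).trans ?_
    rw [← h, mul_zero]
  · refine (finite_lt_norm_coeff f (δ := (p : ℝ)⁻¹ * tateNorm _ hρ f) (by positivity)).subset
      fun I hI => ?_
    by_contra h'
    exact hI (approxCoeff_eq_zero hρ (not_lt.1 h'))

/-- Addition of coefficients is exact, so only the three approximation errors enter, each at most
p⁻¹ times the larger norm. -/
theorem norm_approxCoeff_add_sub_le (f g : weightedTate (Completion B) ρ)
    (I : Fin n →₀ ℕ) :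
    ‖approxCoeff p hρ (f + g) I - (approxCoeff p hρ f I + approxCoeff p hρ g I)‖ ≤
      (p : ℝ)⁻¹ * max (tateNorm _ hρ f) (tateNorm _ hρ g) / monomialWeight ρ I := by
  have hw := monomialWeight_pos hρ I
  have hle : ∀ h : weightedTate (Completion B) ρ,
      tateNorm _ hρ h ≤ max (tateNorm _ hρ f) (tateNorm _ hρ g) →
      ‖MvPowerSeries.coeff I h.1 - approxCoeff p hρ h I‖ ≤
        (p : ℝ)⁻¹ * max (tateNorm _ hρ f) (tateNorm _ hρ g) / monomialWeight ρ I := fun h hh => by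
    refine (norm_coeff_sub_approxCoeff_le hρ h I).trans ?_
    gcongr
  have h1 := hle (f + g) (isNonarchimedean_tateNorm hρ f g)
  have h2 := hle f (le_max_left _ _)
  have h3 := hle g (le_max_right _ _)
  rw [← Completion.norm_coe, Completion.coe_sub,
    Completion.coe_add]
  have h4 : ((approxCoeff p hρ (f + g) I : B) : Completion B) -
      (approxCoeff p hρ f I + approxCoeff p hρ g I) =
      ((MvPowerSeries.coeff I f.1 - approxCoeff p hρ f I) +
        (MvPowerSeries.coeff I g.1 - approxCoeff p hρ g I)) -
      (MvPowerSeries.coeff I (f + g).1 - approxCoeff p hρ (f + g) I) := by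
    rw [Subring.coe_add, map_add]; ring
  rw [h4]
  exact (norm_sub_le_max _ _).trans
    (max_le ((IsUltrametricDist.norm_add_le_max _ _).trans (max_le h2 h3)) h1)

end Coeff

variable {r : ℝ} {L : Type*} [NontriviallyNormedField L] [IsUltrametricDist L]
  (X : DigitExpansion p r L B) (hρ : ∀ i, 0 < ρ i)

variable (ρ) in
/-- The product of the monomial of `B` given by `a`, `k` with `T ^ K`, in the weighted Tate algebra. -/
noncomputable def tateMonomial (a : L) (K : Fin n →₀ ℕ) (k : ℕ) :
    weightedTate (Completion B) ρ :=
  ⟨MvPowerSeries.monomial K (X.mono a k : Completion B),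
    MvPowerSeries.isRestricted_monomial _ _ _⟩

theorem coeff_tateMonomial_mul_add (a : L) (K : Fin n →₀ ℕ) (k : ℕ)
    (f : weightedTate (Completion B) ρ) (I : Fin n →₀ ℕ) :
    MvPowerSeries.coeff (I + K) (X.tateMonomial ρ a K k * f).1 =
      (X.mono a k : Completion B) * MvPowerSeries.coeff I f.1 := by
  rw [add_comm]
  exact MvPowerSeries.coeff_add_monomial_mul _ _ _ _

theorem coeff_tateMonomial_mul_of_not_le (a : L) {K : Fin n →₀ ℕ} (k : ℕ)
    (f : weightedTate (Completion B) ρ) {I : Fin n →₀ ℕ} (h : ¬ K ≤ I) :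
    MvPowerSeries.coeff I (X.tateMonomial ρ a K k * f).1 = 0 :=
  (MvPowerSeries.coeff_monomial_mul _ _ _ _).trans (if_neg h)

theorem norm_mono_mul_coe_le (a : L) (k : ℕ) (x : Completion B) :
    ‖(X.mono a k : Completion B) * x‖ ≤ termSize r p k a * ‖x‖ := by
  induction x using Completion.induction_on with
  | hp => exact isClosed_le (by fun_prop) (by fun_prop)
  | ih x =>
    rw [← Completion.coe_mul, Completion.norm_coe,
      Completion.norm_coe]
    exact X.norm_mono_mul_le a k x

theorem tateNorm_tateMonomial_mul_le (a : L) (K : Fin n →₀ ℕ) (k : ℕ)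
    (f : weightedTate (Completion B) ρ) :
    tateNorm _ hρ (X.tateMonomial ρ a K k * f) ≤
      termSize r p k a * monomialWeight ρ K * tateNorm _ hρ f := by
  refine tateNorm_le hρ fun I => ?_
  have hK := monomialWeight_pos hρ K
  by_cases h : K ≤ I
  · obtain ⟨J, rfl⟩ := exists_add_of_le h
    rw [add_comm K J, X.coeff_tateMonomial_mul_add, monomialWeight_add]
    calc _ ≤ termSize r p k a * ‖MvPowerSeries.coeff J f.1‖ *
          (monomialWeight ρ J * monomialWeight ρ K) :=
          mul_le_mul_of_nonneg_right (X.norm_mono_mul_coe_le a k _)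
            (mul_nonneg (monomialWeight_pos hρ J).le hK.le)
      _ = termSize r p k a * monomialWeight ρ K *
          (‖MvPowerSeries.coeff J f.1‖ * monomialWeight ρ J) := by ring
      _ ≤ _ := mul_le_mul_of_nonneg_left (norm_coeff_mul_le_tateNorm hρ f J)
          (mul_nonneg (termSize_nonneg _ _) hK.le)
  · rw [X.coeff_tateMonomial_mul_of_not_le a k f h, norm_zero, zero_mul]
    exact mul_nonneg (mul_nonneg (termSize_nonneg _ _) hK.le) (apply_nonneg _ _)

/-- Two errors contribute: the approximation of the product's coefficient, and the monomial times
the approximation error for f. The weights multiply, so both have the same bound. -/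
theorem norm_approxCoeff_monomial_mul_sub_le (a : L) (K : Fin n →₀ ℕ) (k : ℕ)
    (f : weightedTate (Completion B) ρ) (I : Fin n →₀ ℕ) :
    ‖approxCoeff p hρ (X.tateMonomial ρ a K k * f) (I + K) -
        X.mono a k * approxCoeff p hρ f I‖ ≤
      (p : ℝ)⁻¹ * (termSize r p k a * monomialWeight ρ K * tateNorm _ hρ f) /
        monomialWeight ρ (I + K) := by
  have hI := monomialWeight_pos hρ I
  have hK := monomialWeight_pos hρ K
  have hIK := monomialWeight_pos hρ (I + K)
  have h1 := norm_coeff_sub_approxCoeff_le (p := p) hρ (X.tateMonomial ρ a K k * f) (I + K)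
  have h2 : (p : ℝ)⁻¹ * tateNorm _ hρ (X.tateMonomial ρ a K k * f) / monomialWeight ρ (I + K) ≤
      (p : ℝ)⁻¹ * (termSize r p k a * monomialWeight ρ K * tateNorm _ hρ f) /
        monomialWeight ρ (I + K) := by
    gcongr
    exact X.tateNorm_tateMonomial_mul_le hρ a K k f
  have h3 := (X.norm_mono_mul_coe_le a k (MvPowerSeries.coeff I f.1 -
    approxCoeff p hρ f I)).trans (mul_le_mul_of_nonneg_left
      (norm_coeff_sub_approxCoeff_le (p := p) hρ f I) (termSize_nonneg _ _))
  have h4 : termSize r p k a * ((p : ℝ)⁻¹ * tateNorm _ hρ f / monomialWeight ρ I) =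
      (p : ℝ)⁻¹ * (termSize r p k a * monomialWeight ρ K * tateNorm _ hρ f) /
        monomialWeight ρ (I + K) := by
    rw [monomialWeight_add]; field_simp
  rw [h4] at h3
  rw [← Completion.norm_coe, Completion.coe_sub,
    Completion.coe_mul]
  have h5 : ((approxCoeff p hρ (X.tateMonomial ρ a K k * f) (I + K) : B) : Completion B) -
      X.mono a k * approxCoeff p hρ f I =
      X.mono a k * (MvPowerSeries.coeff I f.1 - approxCoeff p hρ f I) -
      (MvPowerSeries.coeff (I + K) (X.tateMonomial ρ a K k * f).1 -
        approxCoeff p hρ (X.tateMonomial ρ a K k * f) (I + K)) := by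
    rw [X.coeff_tateMonomial_mul_add]; ring
  rw [h5]
  exact (norm_sub_le_max _ _).trans (max_le h3 (h1.trans h2))

/-- Relative precision p⁻¹ survives the extraction of digits, since the carries cost no more than
p⁻¹. -/
theorem termSize_d_sub_le {x y : B} {C : ℝ}
    (h1 : ‖x - y‖ ≤ (p : ℝ)⁻¹ * C) (h2 : ‖y‖ ≤ C) (k : ℕ) :
    termSize r p k (X.d x k - X.d y k) ≤ (p : ℝ)⁻¹ * C :=
  (X.sub x y k).trans (max_le h1 (by gcongr))

theorem weight_mul_rpowAbs_le_iff (hρ : ∀ i, 0 < ρ i) (hr : 0 < r) (I : Fin n →₀ ℕ) (k : ℕ) (a : L) (C : ℝ) :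
    monomialWeight ρ I * (p : ℝ) ^ (-(k : ℤ)) * rpowAbs L hr a ≤ C ↔
      termSize r p k a ≤ C / monomialWeight ρ I := by
  rw [le_div_iff₀' (monomialWeight_pos hρ I), mul_assoc]; rfl

/-- The expansion of the elements of a weighted Tate algebra in monomials, obtained from the
expansions of approximations of the coefficients. -/
noncomputable def tateExpansion (hr : 0 < r) :
    ApproxExpansion (Lex (Fin n →₀ ℕ) ×ₗ ℕ) L (weightedTate (Completion B) ρ) where
  v := rpowAbs L hr
  v_add := isNonarchimedean_rpowAbs L hr
  w J := monomialWeight ρ (ofLex (ofLex J).1) * (p : ℝ) ^ (-((ofLex J).2 : ℤ))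
  w_pos J := by
    have hp : (0 : ℝ) < p := by exact_mod_cast (Fact.out : p.Prime).pos
    exact mul_pos (monomialWeight_pos hρ _) (by positivity)
  w_add J K := by
    have hp : (p : ℝ) ≠ 0 := by exact_mod_cast (Fact.out : p.Prime).ne_zero
    have h : monomialWeight ρ (ofLex (ofLex (J + K)).1) = _ :=
      monomialWeight_add (ofLex (ofLex J).1) (ofLex (ofLex K).1)
    have h' : (-((ofLex (J + K)).2 : ℤ)) = -((ofLex J).2 : ℤ) + -((ofLex K).2 : ℤ) := by
      rw [← neg_add, ← Nat.cast_add]; rfl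
    rw [h, h', zpow_add₀ hp]
    ring
  N := tateNorm _ hρ
  N_add := isNonarchimedean_tateNorm hρ
  complete a b hb hb0 hab := exists_tateNorm_sub_sum_le hρ a b hb hb0 hab
  θ := (p : ℝ)⁻¹
  θ_nonneg := by positivity
  θ_lt := inv_prime_lt_one
  c f J := X.d (approxCoeff p hρ f (ofLex (ofLex J).1)) (ofLex J).2
  finite f := by
    have hp : (0 : ℝ) < p := by exact_mod_cast (Fact.out : p.Prime).pos
    have hlt : ∀ J : Lex (Fin n →₀ ℕ) ×ₗ ℕ, (p : ℝ)⁻¹ * tateNorm _ hρ f <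
        monomialWeight ρ (ofLex (ofLex J).1) * (p : ℝ) ^ (-((ofLex J).2 : ℤ)) *
          rpowAbs L hr (X.d (approxCoeff p hρ f (ofLex (ofLex J).1)) (ofLex J).2) →
        (p : ℝ)⁻¹ * tateNorm _ hρ f / monomialWeight ρ (ofLex (ofLex J).1) <
          termSize r p (ofLex J).2 (X.d (approxCoeff p hρ f (ofLex (ofLex J).1)) (ofLex J).2) :=
      fun J hJ => by
        contrapose! hJ
        exact (weight_mul_rpowAbs_le_iff hρ hr _ _ _ _).2 hJ
    rcases (apply_nonneg (tateNorm (Completion B) hρ) f).eq_or_lt with h | h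
    · refine Set.finite_empty.subset fun J hJ => ?_
      have h1 := (hlt J hJ).trans_le ((X.le_norm _ _).trans (norm_approxCoeff_le hρ f _))
      rw [← h] at h1
      simp at h1
    -- Only finitely many I have a nonzero approximate coefficient, and each of these has finitely
    -- many digits above the positive threshold.
    · refine (((finite_approxCoeff_ne_zero (p := p) hρ f).biUnion fun I _ =>
        (X.finite (approxCoeff p hρ f I) (δ := (p : ℝ)⁻¹ * tateNorm _ hρ f / monomialWeight ρ I)
          (div_pos (by positivity) (monomialWeight_pos hρ I))).image
          fun k => (toLex (toLex I, k) : Lex (Fin n →₀ ℕ) ×ₗ ℕ))).subset fun J hJ => ?_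
      refine Set.mem_biUnion (x := ofLex (ofLex J).1) (fun h0 => ?_)
        ⟨(ofLex J).2, hlt J hJ, rfl⟩
      have h1 := (hlt J hJ).trans_le (X.le_norm _ _)
      rw [h0, norm_zero] at h1
      exact absurd h1 (not_lt.2 (div_nonneg (by positivity) (monomialWeight_pos hρ _).le))
  le f J := (weight_mul_rpowAbs_le_iff hρ hr _ _ _ _).2
    ((X.le_norm _ _).trans (norm_approxCoeff_le hρ f _))
  exists_eq f hf := by
    have hpos : 0 < tateNorm (Completion B) hρ f := lt_of_le_of_ne (apply_nonneg _ _)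
      fun h => hf ((tateNorm (Completion B) hρ).eq_zero_of_map_eq_zero' f h.symm)
    obtain ⟨I, hI⟩ := exists_norm_approxCoeff_eq (p := p) hρ hpos
    have hw := monomialWeight_pos hρ I
    obtain ⟨k, hk⟩ := X.exists_eq_norm (approxCoeff p hρ f I) (by rw [hI]; positivity)
    refine ⟨toLex (toLex I, k), ?_⟩
    rw [hI, eq_div_iff hw.ne'] at hk
    rw [← hk, mul_comm _ (monomialWeight ρ I), mul_assoc]
    rfl
  add f g J := by
    rw [weight_mul_rpowAbs_le_iff hρ hr]
    set I := ofLex (ofLex J).1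
    set k := (ofLex J).2
    set D := max (tateNorm _ hρ f) (tateNorm _ hρ g)
    have hw := (monomialWeight_pos hρ I).le
    have hf : ‖approxCoeff p hρ f I‖ ≤ D / monomialWeight ρ I :=
      (norm_approxCoeff_le hρ f I).trans (div_le_div_of_nonneg_right (le_max_left _ _) hw)
    have hg : ‖approxCoeff p hρ g I‖ ≤ D / monomialWeight ρ I :=
      (norm_approxCoeff_le hρ g I).trans (div_le_div_of_nonneg_right (le_max_right _ _) hw)
    -- First the error from approximating the coefficients; then, in `h2`, the error from carries in
    -- the sum of the approximations.
    have h1 : termSize r p k (X.d (approxCoeff p hρ (f + g) I) k -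
        X.d (approxCoeff p hρ f I + approxCoeff p hρ g I) k) ≤
        (p : ℝ)⁻¹ * (D / monomialWeight ρ I) := by
      refine X.termSize_d_sub_le ?_ ?_ k
      · rw [← mul_div_assoc]; exact norm_approxCoeff_add_sub_le hρ f g I
      · rw [← Completion.norm_coe, Completion.coe_add]
        refine (IsUltrametricDist.norm_add_le_max _ _).trans (max_le ?_ ?_)
        · rwa [Completion.norm_coe]
        · rwa [Completion.norm_coe]
    have h2 : termSize r p k (X.d (approxCoeff p hρ f I + approxCoeff p hρ g I) k -
        (X.d (approxCoeff p hρ f I) k + X.d (approxCoeff p hρ g I) k)) ≤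
        (p : ℝ)⁻¹ * (D / monomialWeight ρ I) :=
      (X.add _ _ k).trans (by gcongr; exact max_le hf hg)
    have h3 := termSize_add_le hr k h1 h2
    rwa [sub_add_sub_cancel, ← mul_div_assoc] at h3
  monomial a K := by
    set I := ofLex (ofLex K).1 with hI
    set k := (ofLex K).2 with hk
    have hwk := monomialWeight_pos hρ I
    have hva : rpowAbs L hr a * (monomialWeight ρ I * (p : ℝ) ^ (-(k : ℤ))) =
        termSize r p k a * monomialWeight ρ I := by
      rw [termSize]
      change ‖a‖ ^ r * _ = _
      ring
    rw [hva]
    refine ⟨X.tateMonomial ρ a I k, fun f => ⟨X.tateNorm_tateMonomial_mul_le hρ a I k f,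
      fun J => ?_, fun J hJ => ?_⟩⟩
    · rw [weight_mul_rpowAbs_le_iff hρ hr]
      change termSize r p ((ofLex J).2 + k) (X.d (approxCoeff p hρ _ (ofLex (ofLex J).1 + I))
        ((ofLex J).2 + k) - _) ≤ _ / monomialWeight ρ (ofLex (ofLex J).1 + I)
      rw [← X.d_mono_mul_add, mul_div_assoc]
      refine X.termSize_d_sub_le ?_ ?_ _
      · rw [← mul_div_assoc]
        exact X.norm_approxCoeff_monomial_mul_sub_le hρ a I k f _
      · refine (X.norm_mono_mul_le _ _ _).trans ?_
        rw [monomialWeight_add]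
        have hwJ := monomialWeight_pos hρ (ofLex (ofLex J).1)
        have h := mul_le_mul_of_nonneg_left (norm_approxCoeff_le (p := p) hρ f (ofLex (ofLex J).1))
          (termSize_nonneg (r := r) (p := p) k a)
        refine h.trans (le_of_eq ?_)
        field_simp
    · rw [weight_mul_rpowAbs_le_iff hρ hr]
      set I' := ofLex (ofLex J).1 with hI'
      set k' := (ofLex J).2 with hk'
      have hwJ := monomialWeight_pos hρ I'
      have hnn : 0 ≤ (p : ℝ)⁻¹ * (termSize r p k a * monomialWeight ρ I * tateNorm _ hρ f) /
          monomialWeight ρ I' :=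
        div_nonneg (mul_nonneg (by positivity) (mul_nonneg (mul_nonneg (termSize_nonneg _ _) hwk.le)
          (apply_nonneg _ _))) hwJ.le
      -- An index that is not a translate fails in one of two ways. Either I ≤ I' but k' < k, and
      -- the monomial multiple of the approximate coefficient has zero digit there; or I ≤ I' fails,
      -- and the coefficient itself is zero.
      by_cases hle : I ≤ I'
      · obtain ⟨I₁, hI₁⟩ := exists_add_of_le hle
        have hlt : k' < k := by
          by_contra! hkk
          obtain ⟨k₁, hk₁⟩ := Nat.exists_eq_add_of_le hkk
          refine hJ (toLex (toLex I₁, k₁)) ?_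
          have : J = toLex (toLex I', k') := rfl
          rw [this, hI₁, hk₁, add_comm I, add_comm k]
          rfl
        have h := X.norm_approxCoeff_monomial_mul_sub_le hρ a I k f I₁
        rw [add_comm I₁, ← hI₁] at h
        have h' := X.d_mono_mul_of_lt a k (approxCoeff p hρ f I₁) k' hlt
        have h1 := X.sub (approxCoeff p hρ (X.tateMonomial ρ a I k * f) I')
          (X.mono a k * approxCoeff p hρ f I₁) k'
        rw [h', sub_zero] at h1
        refine h1.trans (max_le h ?_)
        rw [mul_div_assoc]
        gcongr
        refine (X.norm_mono_mul_le _ _ _).trans ?_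
        rw [hI₁, monomialWeight_add]
        have hw₁ := monomialWeight_pos hρ I₁
        have h2 := mul_le_mul_of_nonneg_left (norm_approxCoeff_le (p := p) hρ f I₁)
          (termSize_nonneg (r := r) (p := p) k a)
        refine h2.trans (le_of_eq ?_)
        field_simp
      · have h0 : approxCoeff p hρ (X.tateMonomial ρ a I k * f) I' = 0 := by
          refine approxCoeff_eq_zero hρ ?_
          rw [X.coeff_tateMonomial_mul_of_not_le a k f hle, norm_zero, zero_mul]
          positivity
        rw [h0]
        refine (X.le_norm 0 k').trans ?_
        rwa [norm_zero]

theorem isNoetherianRing_weightedTate (X : DigitExpansion p r L B) (hρ : ∀ i, 0 < ρ i)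
    (hr : 0 < r) : IsNoetherianRing (weightedTate (Completion B) ρ) :=
  (X.tateExpansion hρ hr).isNoetherianRing exists_finset_forall_exists_add

end DigitExpansion

/-- The Teichmüller expansions of the elements of `A_{L,E}`. -/
noncomputable def gaussExpansion {p : ℕ} [Fact p.Prime] {O : Type*} [CommRing O] [IsDomain O]
    [IsDiscreteValuationRing O] [IsAdicComplete (maximalIdeal O) O] [CharP (ResidueField O) p]
    [Finite (ResidueField O)] {L : Type*} [NontriviallyNormedField L] [IsUltrametricDist L]
    [CharP L p] [PerfectRing L p] [Algebra (ResidueField O) L] {ϖ : O} (hϖ : Irreducible ϖ)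
    {r : ℝ} (hr : 0 < r) : DigitExpansion p r L (GaussAInt p L hϖ hr) where
  d := gaussDigit hϖ
  le_norm := termSize_le_norm
  finite x _ hδ := finite_lt_termSize x hδ
  exists_eq_norm := exists_termSize_eq_norm
  add := termSize_gaussDigit_add_sub_le
  sub := termSize_gaussDigit_sub_le
  mono := gaussMonomial hϖ hr
  norm_mono_mul_le := norm_gaussMonomial_mul_le
  d_mono_mul_add := gaussDigit_monomial_mul_add
  d_mono_mul_of_lt a _ x _ := gaussDigit_monomial_mul_of_lt a x

end Robba

theorem theoremT (p : ℕ) [Fact p.Prime]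
    (E : Type*) [NontriviallyNormedField E] [IsUltrametricDist E] [CompleteSpace E]
    [IsDiscreteValuationRing (Robba.integerRing E)] [Finite (IsLocalRing.ResidueField (Robba.integerRing E))]
    [CharP (IsLocalRing.ResidueField (Robba.integerRing E)) p]
    (L : Type*) [NontriviallyNormedField L] [IsUltrametricDist L] [CompleteSpace L]
    [CharP L p] [PerfectRing L p] [Algebra (IsLocalRing.ResidueField (Robba.integerRing E)) L]
    (ϖ : Robba.integerRing E) (hϖ : Irreducible ϖ) (r : ℝ) (hr : 0 < r)
    (n : ℕ) (ρ : Fin n → ℝ) (hρ : ∀ i, 0 < ρ i) :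
    IsNoetherianRing (Robba.weightedTate (Robba.RobbaInt p L hϖ hr) ρ) :=
  (Robba.gaussExpansion hϖ hr).isNoetherianRing_weightedTate hρ hr
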